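/- Let $p\ge 0$ and $q\ge 1$ be integers, let $\mathbb{R}_{p+q}$ be the real Clifford algebra generated by $e_1,\dots,e_{p+q}$ with $e_ie_j+e_je_i=-2\delta_{ij}$, let $\mathbb{C}_{p+q}=\mathbb{R}_{p+q}\otimes\mathbb{C}$, and put $e_0=1$. Write points of $\mathbb{R}^{p+q+1}=\mathbb{R}^{p+1}\oplus\mathbb{R}^q$ as $x+\underline{y}$ with $x=\sum_{i=0}^p x_ie_i$ and $\underline{y}=\sum_{i=p+1}^{p+q}x_ie_i$. Put $D_x=\sum_{i=0}^p e_i\partial_{x_i}$ and let $\mathbb{S}$ be the unit sphere of $\mathbb{R}^q$. A function $f:\Omega\to\mathbb{C}_{p+q}$ on a domain $\Omega\subseteq\mathbb{R}^{p+q+1}$ is called generalized partial-slice monogenic if for every $\underline{\omega}\in\mathbb{S}$ the function $(x,r)\mapsto f(x+r\underline{\omega})$ is continuously differentiable on $\{(x,r)\in\mathbb{R}^{p+1}\times\mathbb{R}: x+r\underline{\omega}\in\Omega\}$ and satisfies $(D_x+\underline{\omega}\,\partial_r)f(x+r\underline{\omega})=0$ there. A CK-extension of $f_0:\mathbb{R}^{p+1}\to\mathbb{C}_{p+q}$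 to $\mathbb{R}^{p+q+1}$ is a generalized partial-slice monogenic function $f$ on $\mathbb{R}^{p+q+1}$ with $f(x)=f_0(x)$ for all $x\in\mathbb{R}^{p+1}$. **Corollary.** Let $f_0:\mathbb{R}^{p+1}\to\mathbb{C}_{p+q}$ be a real analytic function whose Taylor series about $0$ converges as a multiple power series on $\mathbb{R}^{p+1}$, that is, for every $x\in\mathbb{R}^{p+1}$ the family $\frac{x^{\mathrm{k}}}{\mathrm{k}!}\,\partial_{\mathrm{k}}f_0(0)$, $\mathrm{k}\in\mathbb{N}_0^{p+1}$, is summable. Then the series $$CK[f_0](x+\underline{y})=\sum_{k=0}^{\infty}\frac{1}{k!}(\underline{y}D_x)^kf_0(x)$$ converges absolutely for every $x+\underline{y}\in\mathbb{R}^{p+q+1}$, and $CK[f_0]$ is the unique CK-extension of $f_0$ to $\mathbb{R}^{p+q+1}$. -/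

import Mathlib

open scoped TensorProduct

/-! ## The real Clifford algebra and its standard basis -/

/-- The quadratic form `-(v₁² + ⋯ + vₙ²)` on `ℝⁿ`. -/
noncomputable def cliffordForm (n : ℕ) : QuadraticForm ℝ (Fin n → ℝ) :=
  QuadraticMap.weightedSumSquares ℝ (fun _ : Fin n => (-1 : ℝ))

/-- The real Clifford algebra `ℝₙ`. -/
abbrev RealClifford (n : ℕ) : Type := CliffordAlgebra (cliffordForm n)

/-- The generators `e₁, …, eₙ` of `ℝₙ` (indexed from `0` to `n - 1`). -/
noncomputable def RealClifford.gen {n : ℕ} (i : Fin n) : RealClifford n :=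
  CliffordAlgebra.ι (cliffordForm n) (Pi.single i 1)

/-- `e_A = e_{j₁} ⋯ e_{j_k}` for `A = {j₁ < ⋯ < j_k}`. -/
noncomputable def RealClifford.blade {n : ℕ} (A : Finset (Fin n)) : RealClifford n :=
  ((A.sort (· ≤ ·)).map RealClifford.gen).prod

namespace RealClifford

theorem gen_mul_self {n : ℕ} (i : Fin n) : (gen i : RealClifford n) * gen i = -1 := by
  rw [gen, CliffordAlgebra.ι_sq_scalar]
  have : cliffordForm n (Pi.single i 1) = -1 := by
    simp [cliffordForm, QuadraticMap.weightedSumSquares_apply, Pi.single_apply]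
  rw [this]; simp

theorem cliffordForm_polar {n : ℕ} (i j : Fin n) :
    QuadraticMap.polar (cliffordForm n) (Pi.single i 1) (Pi.single j 1) =
      if i = j then -2 else 0 := by
  have h : ∀ k : Fin n, -((Pi.single i 1 + Pi.single j 1 : Fin n → ℝ) k *
      (Pi.single i 1 + Pi.single j 1 : Fin n → ℝ) k) =
      -(if k = i then 1 else 0) - (if k = j then 1 else 0)
        - 2 * (if k = i then (if i = j then 1 else 0) else 0) := by
    intro k
    simp only [Pi.add_apply, Pi.single_apply]
    split_ifs <;> first | (exfalso; subst_vars; contradiction) | norm_num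
  simp only [QuadraticMap.polar, cliffordForm, QuadraticMap.weightedSumSquares_apply, smul_eq_mul,
    neg_one_mul, h]
  simp only [Finset.sum_sub_distrib, Finset.sum_neg_distrib, ← Finset.mul_sum]
  simp [Pi.single_apply]
  split_ifs <;> norm_num

/-- The defining relations `eᵢ eⱼ + eⱼ eᵢ = -2 δᵢⱼ`. -/
theorem gen_mul_gen_add {n : ℕ} (i j : Fin n) :
    (gen i : RealClifford n) * gen j + gen j * gen i = if i = j then -2 else 0 := by
  rw [gen, gen, CliffordAlgebra.ι_mul_ι_add_swap, cliffordForm_polar]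
  split_ifs
  · rw [map_neg, map_ofNat]
  · rw [map_zero]

/-- The sign in `eᵢ e_A = ± e_{A ∆ {i}}`. -/
noncomputable def bladeSign {n : ℕ} (i : Fin n) (A : Finset (Fin n)) : ℝ :=
  ∏ k ∈ A, if k ≤ i then -1 else 1

theorem bladeSign_symmDiff {n : ℕ} (i j : Fin n) (A : Finset (Fin n)) :
    bladeSign i (symmDiff A {j}) = bladeSign i A * if j ≤ i then -1 else 1 := by
  by_cases h : j ∈ A
  · have : symmDiff A {j} = A.erase j := by
      ext k; simp only [Finset.mem_symmDiff, Finset.mem_singleton, Finset.mem_erase]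
      by_cases hk : k = j <;> simp [hk, h]
    rw [this, bladeSign, bladeSign, ← Finset.mul_prod_erase _ _ h]
    split_ifs <;> ring
  · have : symmDiff A {j} = insert j A := by
      ext k; simp only [Finset.mem_symmDiff, Finset.mem_singleton, Finset.mem_insert]
      by_cases hk : k = j <;> simp [hk, h]
    rw [this, bladeSign, bladeSign, Finset.prod_insert h, mul_comm]

theorem bladeSign_mul_self {n : ℕ} (i : Fin n) (A : Finset (Fin n)) :
    bladeSign i A * bladeSign i A = 1 := by
  rw [bladeSign, ← Finset.prod_mul_distrib]
  exact Finset.prod_eq_one fun k _ => by split_ifs <;> norm_num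

/-- Left multiplication by `eᵢ` on coordinates. -/
noncomputable def genAction {n : ℕ} (i : Fin n) : Module.End ℝ (Finset (Fin n) →₀ ℝ) :=
  Finsupp.linearCombination ℝ
    fun A => bladeSign i A • Finsupp.single (symmDiff A {i}) (1 : ℝ)

theorem genAction_single {n : ℕ} (i : Fin n) (A : Finset (Fin n)) :
    genAction i (Finsupp.single A 1) =
      bladeSign i A • Finsupp.single (symmDiff A {i}) (1 : ℝ) := by
  simp [genAction]

theorem genAction_mul_add {n : ℕ} (i j : Fin n) :
    genAction i * genAction j + genAction j * genAction i =
      algebraMap ℝ (Module.End ℝ (Finset (Fin n) →₀ ℝ)) (if i = j then -2 else 0) := by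
  refine Finsupp.lhom_ext' fun A => LinearMap.ext_ring ?_
  simp only [LinearMap.comp_apply, Finsupp.lsingle_apply, LinearMap.add_apply,
    Module.End.mul_apply, genAction_single, map_smul, bladeSign_symmDiff, smul_smul,
    Module.algebraMap_end_apply]
  by_cases h : i = j
  · subst h
    rw [symmDiff_assoc, symmDiff_self, symmDiff_bot]
    have := bladeSign_mul_self i A
    simp only [le_refl, if_true, ← mul_assoc, this]
    rw [← add_smul]; norm_num
  · have h1 : symmDiff (symmDiff A {j}) {i} = symmDiff (symmDiff A {i}) ({j} : Finset (Fin n)) :=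
      symmDiff_right_comm _ _ _
    rw [h1, ← add_smul]
    rcases lt_or_gt_of_ne h with hl | hl
    · simp [h, hl.le, hl.not_ge, mul_comm]
    · simp [h, hl.le, hl.not_ge, mul_comm]

/-- The left regular representation of `ℝₙ` in coordinates. -/
noncomputable def leftAction (n : ℕ) :
    RealClifford n →ₐ[ℝ] Module.End ℝ (Finset (Fin n) →₀ ℝ) :=
  CliffordAlgebra.lift (cliffordForm n)
    ⟨Fintype.linearCombination ℝ (genAction (n := n)), by
      have h2 : IsUnit (2 : Module.End ℝ (Finset (Fin n) →₀ ℝ)) := by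
        have := (IsUnit.mk0 (2 : ℝ) two_ne_zero).map
          (algebraMap ℝ (Module.End ℝ (Finset (Fin n) →₀ ℝ)))
        rwa [map_ofNat] at this
      refine (CliffordAlgebra.forall_mul_self_eq_iff h2 _).2 ?_
      refine LinearMap.pi_ext' fun i => LinearMap.ext_ring (LinearMap.pi_ext' fun j =>
        LinearMap.ext_ring ?_)
      have := genAction_mul_add i j
      rw [← cliffordForm_polar] at this
      simpa [Fintype.linearCombination_apply_single] using this⟩

theorem leftAction_gen {n : ℕ} (i : Fin n) : leftAction n (gen i) = genAction i := by
  simp [leftAction, gen, Fintype.linearCombination_apply_single]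

theorem blade_empty {n : ℕ} : (blade ∅ : RealClifford n) = 1 := by simp [blade]

theorem blade_insert {n : ℕ} (m : Fin n) (A : Finset (Fin n)) (h : ∀ k ∈ A, m < k) :
    (blade (insert m A) : RealClifford n) = gen m * blade A := by
  rw [blade, Finset.sort_insert _ (fun b hb => (h b hb).le) fun hm => (h m hm).false]
  simp [blade]

theorem gen_mul_blade {n : ℕ} (i : Fin n) (A : Finset (Fin n)) :
    gen i * blade A = bladeSign i A • (blade (symmDiff A {i}) : RealClifford n) := by
  induction A using Finset.induction_on_min with
  | empty =>
    have := blade_insert i ∅ (by simp)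
    have h : symmDiff ∅ {i} = ({i} : Finset (Fin n)) := bot_symmDiff _
    rw [← this, h]; simp [bladeSign]
  | insert m A hm ih =>
    have hmA : m ∉ A := fun h => (hm m h).false
    rcases lt_trichotomy i m with hl | rfl | hl
    · have h2 : ∀ k ∈ insert m A, i < k := by
        intro k hk
        rcases Finset.mem_insert.1 hk with rfl | hk
        exacts [hl, hl.trans (hm k hk)]
      have h3 : symmDiff (insert m A) {i} = insert i (insert m A) := by
        ext k; simp only [Finset.mem_symmDiff, Finset.mem_singleton]
        by_cases hk : k = i
        · subst hk; simpa using fun h => (h2 k h).false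
        · simp [hk]
      have h4 : bladeSign i (insert m A) = 1 :=
        Finset.prod_eq_one fun k hk => by simp [(h2 k hk).not_ge]
      rw [h3, blade_insert i _ h2, h4, one_smul]
    · have h3 : symmDiff (insert i A) {i} = A := by
        ext k; simp only [Finset.mem_symmDiff, Finset.mem_singleton, Finset.mem_insert]
        by_cases hk : k = i
        · subst hk; simpa using hmA
        · simp [hk]
      have h4 : bladeSign i (insert i A) = -1 := by
        rw [bladeSign, Finset.prod_insert hmA, Finset.prod_eq_one fun k hk => by
          simp [(hm k hk).not_ge]]
        simp
      rw [h3, blade_insert i _ hm, h4, ← mul_assoc, gen_mul_self]; simp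
    · have h3 : symmDiff (insert m A) {i} = insert m (symmDiff A {i}) := by
        ext k; simp only [Finset.mem_symmDiff, Finset.mem_singleton, Finset.mem_insert]
        by_cases hk : k = m
        · subst hk; simp [hl.ne]
        · simp [hk]
      have h4 : bladeSign i (insert m A) = -bladeSign i A := by
        rw [bladeSign, Finset.prod_insert hmA]; simp [hl.le, bladeSign]
      have h5 : ∀ k ∈ symmDiff A {i}, m < k := by
        intro k hk
        simp only [Finset.mem_symmDiff, Finset.mem_singleton] at hk
        rcases hk with hk | hk
        exacts [hm k hk.1, hk.1 ▸ hl]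
      have h6 : (gen i : RealClifford n) * gen m = -(gen m * gen i) := by
        have := gen_mul_gen_add i m
        rw [if_neg hl.ne'] at this
        exact eq_neg_of_add_eq_zero_left this
      rw [h3, h4, blade_insert m _ hm, blade_insert m _ h5, ← mul_assoc, h6, neg_mul, mul_assoc, ih]
      simp

theorem linearCombination_leftAction {n : ℕ} (a : RealClifford n) :
    ∀ v, Finsupp.linearCombination ℝ blade (leftAction n a v) =
      a * Finsupp.linearCombination ℝ blade v := by
  have hgen : ∀ (i : Fin n) (v : Finset (Fin n) →₀ ℝ),
      Finsupp.linearCombination ℝ blade (genAction i v) =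
        (gen i : RealClifford n) * Finsupp.linearCombination ℝ blade v := by
    intro i v
    induction v using Finsupp.induction_linear with
    | zero => simp
    | add f g hf hg => simp [hf, hg, mul_add]
    | single A c =>
      have : Finsupp.single A c = c • Finsupp.single A (1 : ℝ) := by simp
      rw [this, map_smul, map_smul, map_smul, genAction_single]
      simp [gen_mul_blade]
  induction a using CliffordAlgebra.induction with
  | algebraMap r => intro v; simp [Algebra.algebraMap_eq_smul_one]
  | ι m =>
    intro v
    have : CliffordAlgebra.ι (cliffordForm n) m = ∑ i, m i • gen i := by
      rw [LinearMap.pi_apply_eq_sum_univ]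
      refine Finset.sum_congr rfl fun i _ => ?_
      rw [gen]
      congr 2
      ext j
      simp [Pi.single_apply, eq_comm]
    rw [this]
    simp [leftAction_gen, hgen, Finset.sum_mul]
  | mul a b ha hb => intro v; simp [ha, hb, mul_assoc]
  | add a b ha hb => intro v; simp [ha, hb, add_mul]

theorem leftAction_blade {n : ℕ} (A : Finset (Fin n)) :
    leftAction n (blade A) (Finsupp.single ∅ 1) = Finsupp.single A 1 := by
  induction A using Finset.induction_on_min with
  | empty => simp [blade_empty]
  | insert m A hm ih =>
    have hmA : m ∉ A := fun h => (hm m h).false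
    have h3 : symmDiff A {m} = insert m A := by
      ext k; simp only [Finset.mem_symmDiff, Finset.mem_singleton, Finset.mem_insert]
      by_cases hk : k = m
      · subst hk; simpa using hmA
      · simp [hk]
    have h4 : bladeSign m A = 1 :=
      Finset.prod_eq_one fun k hk => by simp [(hm k hk).not_ge]
    rw [blade_insert m A hm, map_mul, Module.End.mul_apply, ih, leftAction_gen, genAction_single,
      h3, h4, one_smul]

/-- The standard basis `(e_A)_A` of `ℝₙ`. -/
noncomputable def bladeBasis (n : ℕ) : Module.Basis (Finset (Fin n)) ℝ (RealClifford n) :=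
  .ofRepr
    { toFun := fun a => leftAction n a (Finsupp.single ∅ 1)
      map_add' := fun a b => by simp
      map_smul' := fun c a => by simp
      invFun := Finsupp.linearCombination ℝ blade
      left_inv := fun a => by
        rw [linearCombination_leftAction]; simp [blade_empty]
      right_inv := fun v => by
        induction v using Finsupp.induction_linear with
        | zero => simp
        | add f g hf hg => simp_all
        | single A c => simp [leftAction_blade] }

theorem bladeBasis_apply {n : ℕ} (A : Finset (Fin n)) : bladeBasis n A = blade A := by
  simp [bladeBasis]

end RealClifford

/-! ## The complex Clifford algebra -/

/-- The complex Clifford algebra `ℂₙ = ℝₙ ⊗ ℂ`. -/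
def ComplexClifford (n : ℕ) : Type := ℂ ⊗[ℝ] RealClifford n

namespace ComplexClifford

noncomputable instance instRing (n : ℕ) : Ring (ComplexClifford n) :=
  inferInstanceAs (Ring (ℂ ⊗[ℝ] RealClifford n))

noncomputable instance instAlgebra (n : ℕ) : Algebra ℂ (ComplexClifford n) :=
  inferInstanceAs (Algebra ℂ (ℂ ⊗[ℝ] RealClifford n))

/-- The standard basis `(e_A)_A` of `ℂₙ` over `ℂ`. -/
noncomputable def bladeBasis (n : ℕ) : Module.Basis (Finset (Fin n)) ℂ (ComplexClifford n) :=
  Algebra.TensorProduct.basis ℂ (RealClifford.bladeBasis n)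

/-- The coordinates `(λ_A)_A` of `λ = ∑_A λ_A e_A`. -/
noncomputable def coords (n : ℕ) :
    ComplexClifford n ≃ₗ[ℂ] EuclideanSpace ℂ (Finset (Fin n)) :=
  (bladeBasis n).equivFun.trans (WithLp.linearEquiv 2 ℂ (Finset (Fin n) → ℂ)).symm

/-- `ℂₙ` carries the norm `|λ| = (∑_A |λ_A|²)^{1/2}`. -/
noncomputable instance instNormedAddCommGroup (n : ℕ) : NormedAddCommGroup (ComplexClifford n) :=
  NormedAddCommGroup.induced _ _ (coords n) (coords n).injective

noncomputable instance instNormedSpace (n : ℕ) : NormedSpace ℂ (ComplexClifford n) :=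
  NormedSpace.induced ℂ (ComplexClifford n) (EuclideanSpace ℂ (Finset (Fin n))) (coords n)

theorem norm_eq {n : ℕ} (a : ComplexClifford n) :
    ‖a‖ = Real.sqrt (∑ A, ‖(bladeBasis n).repr a A‖ ^ 2) := by
  change ‖coords n a‖ = _
  rw [EuclideanSpace.norm_eq]
  rfl

/-- The generators `e₁, …, eₙ` of `ℂₙ` (indexed from `0` to `n - 1`). -/
noncomputable def gen {n : ℕ} (i : Fin n) : ComplexClifford n :=
  (1 : ℂ) ⊗ₜ[ℝ] (RealClifford.gen i : RealClifford n)

theorem bladeBasis_apply {n : ℕ} (A : Finset (Fin n)) :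
    bladeBasis n A = ((A.sort (· ≤ ·)).map gen).prod := by
  have h : ∀ l : List (Fin n), ((1 : ℂ) ⊗ₜ[ℝ] (l.map RealClifford.gen).prod : ComplexClifford n) =
      (l.map gen).prod := by
    intro l
    induction l with
    | nil => rfl
    | cons i l ih =>
      rw [List.map_cons, List.map_cons, List.prod_cons, List.prod_cons, ← ih]
      change _ = ((1 : ℂ) ⊗ₜ[ℝ] (RealClifford.gen i : RealClifford n)) *
        ((1 : ℂ) ⊗ₜ[ℝ] (l.map RealClifford.gen).prod : ℂ ⊗[ℝ] RealClifford n)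
      rw [Algebra.TensorProduct.tmul_mul_tmul, mul_one]
  rw [← h]
  exact (Algebra.TensorProduct.basis_apply _ A).trans (by rw [RealClifford.bladeBasis_apply]; rfl)

end ComplexClifford

/-! ## Generalized partial-slice monogenic functions -/

namespace PartialSlice

/-- `ℝ^{p+1}`, with coordinates `x₀, …, x_p`. -/
abbrev BaseSpace (p : ℕ) : Type := EuclideanSpace ℝ (Fin (p + 1))

/-- `ℝ^{p+q+1} = ℝ^{p+1} ⊕ ℝ^q`: the pair `(x, y)` stands for the paravector `x + y̲`. Only the
topology and the real vector space structure of this space are used. -/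
abbrev TotalSpace (p q : ℕ) : Type := BaseSpace p × EuclideanSpace ℝ (Fin q)

/-- The elements `e₀ = 1, e₁, …, e_p` of `ℂ_{p+q}`. -/
noncomputable def baseUnit (p q : ℕ) : Fin (p + 1) → ComplexClifford (p + q) :=
  Fin.cons 1 fun i : Fin p => ComplexClifford.gen (Fin.castAdd q i)

/-- The `1`-vector `y̲ = ∑_{i=p+1}^{p+q} yᵢ eᵢ` of `ℂ_{p+q}`. -/
noncomputable def toVector (p : ℕ) {q : ℕ} (y : EuclideanSpace ℝ (Fin q)) :
    ComplexClifford (p + q) :=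
  ∑ j : Fin q, y j • ComplexClifford.gen (Fin.natAdd p j)

/-- The partial derivative `∂_{xᵢ}` on functions on `ℝ^{p+1}`. -/
noncomputable def partialX {p n : ℕ} (i : Fin (p + 1)) (g : BaseSpace p → ComplexClifford n) :
    BaseSpace p → ComplexClifford n :=
  fun x => lineDeriv ℝ g x (EuclideanSpace.single i 1)

/-- The operator `D_x = ∑_{i=0}^p eᵢ ∂_{xᵢ}`. -/
noncomputable def diracX {p q : ℕ} (g : BaseSpace p → ComplexClifford (p + q)) :
    BaseSpace p → ComplexClifford (p + q) :=
  fun x => ∑ i : Fin (p + 1), baseUnit p q i * partialX i g x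

/-- `Ω` is a domain of `ℝ^{p+q+1}` and `f` is (left) generalized partial-slice monogenic of type
`(p, q)` on `Ω`: for every `ω` in the unit sphere `𝕊` of `ℝ^q`, the restriction
`(x, r) ↦ f (x + r ω)` is continuously differentiable on `Ω_ω` and is annihilated there by
`D_x + ω ∂_r`. Only the values of `f` on `Ω` matter. -/
structure IsGSM {p q : ℕ} (Ω : Set (TotalSpace p q))
    (f : TotalSpace p q → ComplexClifford (p + q)) : Prop where
  isOpen : IsOpen Ω
  isConnected : IsConnected Ω
  contDiffOn : ∀ ω : EuclideanSpace ℝ (Fin q), ‖ω‖ = 1 →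
    ContDiffOn ℝ 1 (fun z : BaseSpace p × ℝ => f (z.1, z.2 • ω)) {z | (z.1, z.2 • ω) ∈ Ω}
  cauchyRiemann : ∀ ω : EuclideanSpace ℝ (Fin q), ‖ω‖ = 1 →
    ∀ (x : BaseSpace p) (r : ℝ), (x, r • ω) ∈ Ω →
      diracX (fun x' => f (x', r • ω)) x + toVector p ω * deriv (fun s : ℝ => f (x, s • ω)) r = 0

/-! ## CK-extensions -/

/-- `f` is a (generalized partial-slice) CK-extension to `Ω` of the function `f₀` on
`Ω₀ ⊆ ℝ^{p+1}`: it is generalized partial-slice monogenic on `Ω`, where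
`Ω₀ ⊆ Ω ⊆ Ω₀* = {x + y̲ : x ∈ Ω₀}`, and it agrees with `f₀` on `Ω₀`. -/
structure IsCKExtension {p q : ℕ} (Ω₀ : Set (BaseSpace p))
    (f₀ : BaseSpace p → ComplexClifford (p + q)) (Ω : Set (TotalSpace p q))
    (f : TotalSpace p q → ComplexClifford (p + q)) : Prop where
  subset_cylinder : ∀ z ∈ Ω, z.1 ∈ Ω₀
  base_subset : ∀ x ∈ Ω₀, (x, 0) ∈ Ω
  isGSM : IsGSM Ω f
  restrict_eq : ∀ x ∈ Ω₀, f (x, 0) = f₀ x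

/-- The operator `y̲ D_x`, for fixed `y`. -/
noncomputable def vectorDiracX {p q : ℕ} (y : EuclideanSpace ℝ (Fin q))
    (g : BaseSpace p → ComplexClifford (p + q)) : BaseSpace p → ComplexClifford (p + q) :=
  fun x => toVector p y * diracX g x

/-- The term `(1 / k!) (y̲ D_x)^k f₀(x)` at the point `z = x + y̲`. -/
noncomputable def ckTerm {p q : ℕ} (f₀ : BaseSpace p → ComplexClifford (p + q))
    (z : TotalSpace p q) (k : ℕ) : ComplexClifford (p + q) :=
  ((k.factorial : ℝ)⁻¹) • ((vectorDiracX z.2)^[k] f₀) z.1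

/-- `CK[f₀](x + y̲) = ∑_{k ≥ 0} (1 / k!) (y̲ D_x)^k f₀(x)` (meaningful where the series
converges). -/
noncomputable def CK {p q : ℕ} (f₀ : BaseSpace p → ComplexClifford (p + q))
    (z : TotalSpace p q) : ComplexClifford (p + q) :=
  ∑' k : ℕ, ckTerm f₀ z k

/-! ## Multiple Taylor series -/

/-- `∂_k g = ∂_{x₀}^{k₀} ⋯ ∂_{x_p}^{k_p} g` for a multi-index `k = (k₀, …, k_p)`. -/
noncomputable def mixedPartial {p n : ℕ} (k : Fin (p + 1) → ℕ)
    (g : BaseSpace p → ComplexClifford n) : BaseSpace p → ComplexClifford n :=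
  (List.finRange (p + 1)).foldr (fun i h => (partialX i)^[k i] h) g

/-- The term `(x^k / k!) ∂_k f₀(0)` of the Taylor series of `f₀` about `0`. -/
noncomputable def taylorTerm {p n : ℕ} (f₀ : BaseSpace p → ComplexClifford n) (x : BaseSpace p)
    (k : Fin (p + 1) → ℕ) : ComplexClifford n :=
  ((∏ i, x i ^ k i) / (∏ i, ((k i).factorial : ℝ))) • mixedPartial k f₀ 0

end PartialSlice

/-! On the slice of a unit vector ω one has ω² = -1, so multiplying the monogenicity equation by ω
turns it into the evolution system ∂_r u = ∑ Bᵢ ∂ᵢ u, with Bᵢ the left multiplication by ω eᵢ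
(`solvesEvolution_diracCoeff_iff`). On each slice a CK-extension therefore solves a Cauchy problem
with data f₀ at r = 0.

Existence. The formal solution exp(r ∑ Bᵢ ∂ᵢ) f₀ is the CK series at y = rω (`ckTerm_eq_expTerm`).
Everywhere convergence of the multiple Taylor series gives ‖D^m f₀‖ ≤ C m! / R^m on every ball and
for every R, so the terms and their first derivatives decay geometrically up to a linear factor
(`exists_bound_iterate_firstOrderOp`). The series can then be differentiated termwise, and it solves
the system (`contDiff_and_solvesEvolution_tsum_expTerm`).

Uniqueness. The relations BᵢBⱼ + BⱼBᵢ = -2δᵢⱼ (`diracCoeff_mul_add`) make the square of the system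
Laplace's equation, which C¹ solutions satisfy weakly. Hence a mean value property, smoothness and
Cauchy estimates. With zero data every r-derivative vanishes on r = 0, and the estimates force u = 0
in a slab whose thickness does not depend on u (`exists_pos_forall_eq_zero`). Stacking slabs and
reflecting r gives `SolvesEvolution.eq_zero`, applied to the difference of two extensions. -/

namespace PartialSlice

open MeasureTheory Set Filter
open scoped Topology

/-! ### Integration by parts against test functions -/

section IntegrationByParts

variable {V F : Type*} [NormedAddCommGroup V] [MeasurableSpace V] [BorelSpace V]
  [NormedAddCommGroup F] [NormedSpace ℝ F]

theorem integrable_smul_of_hasCompactSupport (μ : Measure V) [μ.IsAddHaarMeasure] {φ : V → ℝ}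
    {u : V → F} (hφ : Continuous φ) (hc : HasCompactSupport φ) (hu : Continuous u) :
    Integrable (fun z => φ z • u z) μ :=
  (hφ.smul hu).integrable_of_hasCompactSupport hc.smul_right

variable [NormedSpace ℝ V] [FiniteDimensional ℝ V]

/-- Swapping the directions of differentiation in `∫ ∂ₐΦ • ∂_b u`. -/
theorem integral_fderiv_smul_fderiv_comm (μ : Measure V) [μ.IsAddHaarMeasure] {Φ : V → ℝ}
    {u : V → F} (hΦ : ContDiff ℝ 2 Φ) (hc : HasCompactSupport Φ) (hu : ContDiff ℝ 1 u) (a b : V) :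
    ∫ z, fderiv ℝ Φ z a • fderiv ℝ u z b ∂μ = ∫ z, fderiv ℝ Φ z b • fderiv ℝ u z a ∂μ := by
  have hΦ' : ContDiff ℝ 1 (fderiv ℝ Φ) := hΦ.fderiv_right (by norm_num)
  have hu' : Continuous (fderiv ℝ u) := hu.continuous_fderiv one_ne_zero
  have hd : ∀ a z b, fderiv ℝ (fun z => fderiv ℝ Φ z a) z b = fderiv ℝ (fderiv ℝ Φ) z b a := by
    intro a z b
    have h := ((hΦ'.differentiable one_ne_zero z).hasFDerivAt.clm_apply
      (hasFDerivAt_const a z)).fderiv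
    rw [h]; simp
  have hca : ∀ a, HasCompactSupport fun z => fderiv ℝ Φ z a := fun a => hc.fderiv_apply ℝ a
  have hda : ∀ a, ContDiff ℝ 1 fun z => fderiv ℝ Φ z a := fun a => hΦ'.clm_apply contDiff_const
  -- Only Φ has two derivatives, so the derivative of u is moved onto Φ, whose second derivative is
  -- symmetric.
  have key : ∀ a b, ∫ z, fderiv ℝ Φ z a • fderiv ℝ u z b ∂μ =
      -∫ z, fderiv ℝ (fderiv ℝ Φ) z b a • u z ∂μ := by
    intro a b
    rw [integral_smul_fderiv_eq_neg_fderiv_smul_of_integrable]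
    · simp only [hd]
    · refine integrable_smul_of_hasCompactSupport μ
        (((hda a).continuous_fderiv one_ne_zero).clm_apply continuous_const)
        ((hca a).fderiv_apply ℝ b) hu.continuous
    · exact integrable_smul_of_hasCompactSupport μ (hda a).continuous (hca a)
        (hu'.clm_apply continuous_const)
    · exact integrable_smul_of_hasCompactSupport μ (hda a).continuous (hca a) hu.continuous
    · exact fun z _ => (hda a).differentiable one_ne_zero z
    · exact fun z _ => hu.differentiable one_ne_zero z
  rw [key, key]
  congr 2
  ext z
  have := (hΦ.contDiffAt (x := z)).isSymmSndFDerivAt (by simp)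
  rw [this b a]

end IntegrationByParts

/-! ### The evolution system and weak harmonicity -/

section Evolution

variable {ι F : Type*} [Fintype ι] [DecidableEq ι] [NormedAddCommGroup F] [NormedSpace ℝ F]

/-- The first order system `∂_r u = ∑ᵢ Bᵢ ∂ᵢ u` on `ℝ^ι × ℝ`. -/
def SolvesEvolution (B : ι → F →L[ℝ] F) (u : EuclideanSpace ℝ ι × ℝ → F) : Prop :=
  ∀ z, fderiv ℝ u z (0, 1) = ∑ i, B i (fderiv ℝ u z (EuclideanSpace.single i 1, 0))

variable {B : ι → F →L[ℝ] F} {u : EuclideanSpace ℝ ι × ℝ → F}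

theorem fderiv_comp_add_smul {V : Type*} [NormedAddCommGroup V] [NormedSpace ℝ V] {u : V → F}
    (hu : ContDiff ℝ 1 u) (x : V) (t : ℝ) (z a : V) :
    fderiv ℝ (fun z => u (x + t • z)) z a = t • fderiv ℝ u (x + t • z) a := by
  have h1 : HasFDerivAt (fun z : V => x + t • z) (t • ContinuousLinearMap.id ℝ V) z :=
    ((hasFDerivAt_id z).const_smul t).const_add x
  have h2 := ((hu.differentiable one_ne_zero (x + t • z)).hasFDerivAt.comp z h1).fderiv
  have h3 : fderiv ℝ (fun z => u (x + t • z)) z =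
    (fderiv ℝ u (x + t • z)).comp (t • ContinuousLinearMap.id ℝ V) := h2
  rw [h3]; simp

/-- The system is homogeneous of first order with constant coefficients, hence invariant under
translations and dilations. -/
theorem SolvesEvolution.comp_add_smul (hu : ContDiff ℝ 1 u) (h : SolvesEvolution B u)
    (x : EuclideanSpace ℝ ι × ℝ) (t : ℝ) : SolvesEvolution B fun z => u (x + t • z) := by
  intro z
  simp only [fderiv_comp_add_smul hu, map_smul, h (x + t • z), Finset.smul_sum]

/-- This linear part replaces the dilated solution in the degenerate case of dilation factor 0. -/
theorem SolvesEvolution.fderiv_const (h : SolvesEvolution B u) (x : EuclideanSpace ℝ ι × ℝ) :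
    SolvesEvolution B fun z => fderiv ℝ u x z := by
  intro z
  have : fderiv ℝ (fun z => fderiv ℝ u x z) z = fderiv ℝ u x := (fderiv ℝ u x).fderiv
  rw [this]
  exact h x

/-- Directional derivatives of solutions are solutions. -/
theorem SolvesEvolution.fderiv_apply (hu : ContDiff ℝ 2 u) (h : SolvesEvolution B u)
    (v : EuclideanSpace ℝ ι × ℝ) : SolvesEvolution B fun z => fderiv ℝ u z v := by
  have hu' : Differentiable ℝ (fderiv ℝ u) :=
    (hu.fderiv_right (m := 1) (by norm_num)).differentiable one_ne_zero
  have hd : ∀ v z a, fderiv ℝ (fun z => fderiv ℝ u z v) z a = fderiv ℝ (fderiv ℝ u) z a v := by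
    intro v z a
    have h := ((hu' z).hasFDerivAt.clm_apply (hasFDerivAt_const v z)).fderiv
    rw [h]; simp
  have hs : ∀ z a b, fderiv ℝ (fderiv ℝ u) z a b = fderiv ℝ (fderiv ℝ u) z b a := fun z a b =>
    (hu.contDiffAt (x := z)).isSymmSndFDerivAt (by simp) a b
  intro z
  simp only [hd]
  rw [hs, ← hd]
  have e : (fun z => fderiv ℝ u z (0, 1)) =
      fun z => ∑ i, B i (fderiv ℝ u z (EuclideanSpace.single i 1, 0)) := funext h
  have hp : ∀ i, HasFDerivAt (fun z => B i (fderiv ℝ u z (EuclideanSpace.single i 1, 0)))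
      ((B i).comp (fderiv ℝ (fun z => fderiv ℝ u z (EuclideanSpace.single i 1, 0)) z)) z := by
    intro i
    refine (B i).hasFDerivAt.comp z (DifferentiableAt.hasFDerivAt ?_)
    exact (hu' z).clm_apply (differentiableAt_const _)
  rw [e, (HasFDerivAt.fun_sum fun i _ => hp i).fderiv]
  simp only [_root_.sum_apply, ContinuousLinearMap.comp_apply, hd]
  exact Finset.sum_congr rfl fun i _ => by rw [hs]

theorem isAddHaarMeasure_volume_prod {E : Type*} [NormedAddCommGroup E] [InnerProductSpace ℝ E]
    [FiniteDimensional ℝ E] [MeasurableSpace E] [BorelSpace E] :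
    (volume : Measure (E × ℝ)).IsAddHaarMeasure :=
  Measure.prod.instIsAddHaarMeasure volume volume

attribute [local instance] isAddHaarMeasure_volume_prod

/-- Weak harmonicity. As u is only C¹, the system cannot be applied twice pointwise. It is applied
twice to the integrals `I a b`, which are symmetric in a and b; the anticommutation relations then
leave only the diagonal terms. -/
theorem integral_fderiv_smul_fderiv_eq_zero [CompleteSpace F]
    (hB : ∀ i j, B i * B j + B j * B i = if i = j then -2 else 0)
    (hu : ContDiff ℝ 1 u) (h : SolvesEvolution B u) {Φ : EuclideanSpace ℝ ι × ℝ → ℝ}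
    (hΦ : ContDiff ℝ 2 Φ) (hc : HasCompactSupport Φ) :
    ∫ z, (fderiv ℝ Φ z (0, 1) • fderiv ℝ u z (0, 1) +
      ∑ i, fderiv ℝ Φ z (EuclideanSpace.single i 1, 0) •
        fderiv ℝ u z (EuclideanSpace.single i 1, 0)) = 0 := by
  set e : ι → EuclideanSpace ℝ ι × ℝ := fun i => (EuclideanSpace.single i 1, 0)
  set ν : EuclideanSpace ℝ ι × ℝ := (0, 1)
  set I : EuclideanSpace ℝ ι × ℝ → EuclideanSpace ℝ ι × ℝ → F :=
    fun a b => ∫ z, fderiv ℝ Φ z a • fderiv ℝ u z b with hI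
  have hint : ∀ a b, Integrable (fun z => fderiv ℝ Φ z a • fderiv ℝ u z b) := fun a b =>
    integrable_smul_of_hasCompactSupport volume
      ((hΦ.continuous_fderiv two_ne_zero).clm_apply continuous_const) (hc.fderiv_apply ℝ a)
      ((hu.continuous_fderiv one_ne_zero).clm_apply continuous_const)
  have hcomm : ∀ a b, I a b = I b a := integral_fderiv_smul_fderiv_comm volume hΦ hc hu
  have hpde : ∀ a, I a ν = ∑ i, B i (I a (e i)) := by
    intro a
    simp only [hI]
    have : ∀ z, fderiv ℝ Φ z a • fderiv ℝ u z ν =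
        ∑ i, B i (fderiv ℝ Φ z a • fderiv ℝ u z (e i)) := by
      intro z
      rw [h z, Finset.smul_sum]
      exact Finset.sum_congr rfl fun i _ => ((B i).map_smul _ _).symm
    simp only [this]
    rw [integral_finsetSum _ fun i _ => (B i).integrable_comp (hint a (e i))]
    exact Finset.sum_congr rfl fun i _ => (B i).integral_comp_comm (hint a (e i))
  have hS : I ν ν = ∑ i, ∑ j, (B i * B j) (I (e i) (e j)) := by
    rw [hpde]
    refine Finset.sum_congr rfl fun i _ => ?_
    rw [hcomm, hpde, map_sum]
    rfl
  -- The same double sum relabelled, so that adding the two copies produces anticommutators.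
  have hS2 : I ν ν = ∑ i, ∑ j, (B j * B i) (I (e i) (e j)) := by
    rw [hS, Finset.sum_comm]
    exact Finset.sum_congr rfl fun i _ => Finset.sum_congr rfl fun j _ => by rw [hcomm]
  have h2 : I ν ν + I ν ν = -(2 : ℝ) • ∑ i, I (e i) (e i) := by
    nth_rewrite 1 [hS]
    rw [hS2, ← Finset.sum_add_distrib, Finset.smul_sum]
    refine Finset.sum_congr rfl fun i _ => ?_
    rw [← Finset.sum_add_distrib, Finset.sum_eq_single i]
    · rw [← _root_.add_apply, hB, if_pos rfl]
      have : (-2 : F →L[ℝ] F) = (-2 : ℝ) • (1 : F →L[ℝ] F) := by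
        rw [neg_smul, ofNat_smul_eq_nsmul, nsmul_eq_mul, mul_one]; rfl
      rw [this]; simp
    · intro j _ hj
      rw [← _root_.add_apply, hB, if_neg hj.symm]; simp
    · simp
  rw [integral_add (hint _ _) (integrable_finsetSum _ fun i _ => hint _ _),
    integral_finsetSum _ fun i _ => hint _ _]
  change I ν ν + ∑ i, I (e i) (e i) = 0
  have h3 : (2 : ℝ) • (I ν ν + ∑ i, I (e i) (e i)) = 0 := by
    rw [smul_add, two_smul, h2, ← add_smul]; simp
  exact (smul_eq_zero.1 h3).resolve_left two_ne_zero

end Evolution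

/-! ### A radial density and its potential -/

section RadialBump

variable {E : Type*} [NormedAddCommGroup E]

/-- A smooth radial function supported in the Euclidean unit ball of `E × ℝ`. -/
noncomputable def radialBump (z : E × ℝ) : ℝ :=
  deriv Real.smoothTransition (1 - (‖z.1‖ ^ 2 + z.2 ^ 2))

/-- A potential of the vector field `z ↦ radialBump z • z`. -/
noncomputable def radialPotential (z : E × ℝ) : ℝ :=
  (-1 / 2 : ℝ) * Real.smoothTransition (1 - (‖z.1‖ ^ 2 + z.2 ^ 2))

/-- The ball is that of the sup norm on the product; it contains the Euclidean unit ball. -/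
theorem radialBump_eq_zero {z : E × ℝ} (hz : z ∉ Metric.closedBall (0 : E × ℝ) 1) :
    radialBump z = 0 := by
  have h1 : 1 < ‖z.1‖ ^ 2 + z.2 ^ 2 := by
    simp only [mem_closedBall_zero_iff, not_le, Prod.norm_def, lt_max_iff, Real.norm_eq_abs] at hz
    rcases hz with hz | hz
    · nlinarith [sq_nonneg z.2]
    · nlinarith [sq_nonneg ‖z.1‖, sq_abs z.2]
  have h2 : Real.smoothTransition =ᶠ[𝓝 (1 - (‖z.1‖ ^ 2 + z.2 ^ 2))] fun _ => 0 := by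
    filter_upwards [Iio_mem_nhds (show 1 - (‖z.1‖ ^ 2 + z.2 ^ 2) < 0 by linarith)] with t ht
    exact Real.smoothTransition.zero_of_nonpos (le_of_lt ht)
  rw [radialBump, h2.deriv_eq]; simp

theorem radialPotential_eq_zero {z : E × ℝ} (hz : z ∉ Metric.closedBall (0 : E × ℝ) 1) :
    radialPotential z = 0 := by
  have h1 : 1 < ‖z.1‖ ^ 2 + z.2 ^ 2 := by
    simp only [mem_closedBall_zero_iff, not_le, Prod.norm_def, lt_max_iff, Real.norm_eq_abs] at hz
    rcases hz with hz | hz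
    · nlinarith [sq_nonneg z.2]
    · nlinarith [sq_nonneg ‖z.1‖, sq_abs z.2]
  rw [radialPotential, Real.smoothTransition.zero_of_nonpos (by linarith), mul_zero]

theorem radialBump_nonneg (z : E × ℝ) : 0 ≤ radialBump z :=
  Real.smoothTransition.monotone.deriv_nonneg

variable [InnerProductSpace ℝ E]

theorem contDiff_radialBump {n : ℕ∞} : ContDiff ℝ n (radialBump : E × ℝ → ℝ) := by
  have h : ContDiff ℝ n (deriv Real.smoothTransition) := by
    have h0 : ContDiff ℝ (n + 1) Real.smoothTransition := by
      exact_mod_cast Real.smoothTransition.contDiff (n := n + 1)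
    exact h0.deriv'
  exact h.comp (contDiff_const.sub ((contDiff_fst.norm_sq ℝ).add (contDiff_snd.pow 2)))

theorem contDiff_radialPotential {n : ℕ∞} : ContDiff ℝ n (radialPotential : E × ℝ → ℝ) :=
  contDiff_const.mul (Real.smoothTransition.contDiff.comp
    (contDiff_const.sub ((contDiff_fst.norm_sq ℝ).add (contDiff_snd.pow 2))))

/-- The factor -1/2 in the potential cancels the -2 coming from the derivative of 1 - |z|². -/
theorem fderiv_radialPotential (z a : E × ℝ) :
    fderiv ℝ radialPotential z a = radialBump z * (inner ℝ z.1 a.1 + z.2 * a.2) := by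
  have h1 : HasFDerivAt (fun z : E × ℝ => ‖z.1‖ ^ 2)
      ((2 • (innerSL ℝ z.1)).comp (ContinuousLinearMap.fst ℝ E ℝ)) z := by
    exact HasFDerivAt.comp (g := fun x : E => ‖x‖ ^ 2) z
      (hasStrictFDerivAt_norm_sq z.1).hasFDerivAt hasFDerivAt_fst
  have h2 : HasFDerivAt (fun z : E × ℝ => z.2 ^ 2)
      ((2 * z.2) • (ContinuousLinearMap.snd ℝ E ℝ)) z := by
    have h : HasFDerivAt (fun z : E × ℝ => z.2) (ContinuousLinearMap.snd ℝ E ℝ) z :=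
      hasFDerivAt_snd
    simpa using h.pow 2
  have h3 : HasDerivAt Real.smoothTransition
      (deriv Real.smoothTransition (1 - (‖z.1‖ ^ 2 + z.2 ^ 2))) (1 - (‖z.1‖ ^ 2 + z.2 ^ 2)) :=
    ((Real.smoothTransition.contDiff (n := 1)).differentiable one_ne_zero _).hasDerivAt
  have h4 := ((h3.comp_hasFDerivAt z ((h1.add h2).const_sub 1)).const_mul (-1 / 2 : ℝ)).fderiv
  have h5 : fderiv ℝ radialPotential z = _ := h4
  rw [h5]
  simp [radialBump]
  ring

variable [FiniteDimensional ℝ E]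

theorem hasCompactSupport_radialBump : HasCompactSupport (radialBump : E × ℝ → ℝ) :=
  .intro (isCompact_closedBall _ _) fun _ => radialBump_eq_zero

theorem hasCompactSupport_radialPotential : HasCompactSupport (radialPotential : E × ℝ → ℝ) :=
  .intro (isCompact_closedBall _ _) fun _ => radialPotential_eq_zero

theorem integral_radialBump_pos [MeasurableSpace E] [BorelSpace E] :
    0 < ∫ z : E × ℝ, radialBump z := by
  have := isAddHaarMeasure_volume_prod (E := E)
  -- The transition rises from 0 to 1 on [0, 1], so its derivative is 1 at some t; the point (0, √(1
  -- - t)) has 1 - |z|² = t.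
  obtain ⟨t, ht, htd⟩ := exists_deriv_eq_slope Real.smoothTransition zero_lt_one
    Real.smoothTransition.continuous.continuousOn
    ((Real.smoothTransition.contDiff (n := 1)).differentiable one_ne_zero).differentiableOn
  have hx : radialBump ((0, √(1 - t)) : E × ℝ) ≠ 0 := by
    have : 1 - (‖(0 : E)‖ ^ 2 + √(1 - t) ^ 2) = t := by
      rw [Real.sq_sqrt (by linarith [ht.2])]; simp
    rw [radialBump, this, htd]; simp
  exact (contDiff_radialBump (n := 0)).continuous.integral_pos_of_hasCompactSupport_nonneg_nonzero
    hasCompactSupport_radialBump radialBump_nonneg hx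

end RadialBump

end PartialSlice

namespace PartialSlice

open MeasureTheory Set Filter
open scoped Topology ContDiff

/-! ### Mean value property, smoothness and interior estimates -/

section MeanValue

variable {ι F : Type*} [Fintype ι] [DecidableEq ι] [NormedAddCommGroup F] [NormedSpace ℝ F]
  [CompleteSpace F] {B : ι → F →L[ℝ] F} {u : EuclideanSpace ℝ ι × ℝ → F}

attribute [local instance] isAddHaarMeasure_volume_prod

/-- Weak harmonicity tested against `radialPotential`: its gradient is the density times z, so the
integrand becomes the radial derivative of u. -/
theorem integral_radialBump_smul_fderiv_eq_zero
    (hB : ∀ i j, B i * B j + B j * B i = if i = j then -2 else 0)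
    (hu : ContDiff ℝ 1 u) (h : SolvesEvolution B u) :
    ∫ z, radialBump z • fderiv ℝ u z z = 0 := by
  rw [← integral_fderiv_smul_fderiv_eq_zero hB hu h
    (contDiff_radialPotential (n := 2)) hasCompactSupport_radialPotential]
  congr 1
  ext z
  have hz : z = z.2 • ((0 : EuclideanSpace ℝ ι), (1 : ℝ)) +
      ∑ i, z.1 i • (EuclideanSpace.single i (1 : ℝ), (0 : ℝ)) := by
    refine Prod.ext ?_ ?_
    · simp only [Prod.fst_add, Prod.fst_sum, Prod.smul_fst, smul_zero, zero_add]
      simpa using ((EuclideanSpace.basisFun ι ℝ).sum_repr z.1).symm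
    · simp [Prod.snd_sum]
  have hDz : ∀ L : EuclideanSpace ℝ ι × ℝ →L[ℝ] F, L z = z.2 • L (0, 1) +
      ∑ i, z.1 i • L (EuclideanSpace.single i 1, 0) := by
    intro L
    conv_lhs => rw [hz]
    simp only [map_add, map_sum, map_smul]
  rw [hDz]
  simp only [smul_add, Finset.smul_sum, fderiv_radialPotential, smul_smul]
  simp [EuclideanSpace.inner_single_right]

/-- Mean value property of solutions, with respect to a radial density. -/
theorem SolvesEvolution.integral_radialBump_smul
    (hB : ∀ i j, B i * B j + B j * B i = if i = j then -2 else 0)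
    (hu : ContDiff ℝ 1 u) (h : SolvesEvolution B u) (x : EuclideanSpace ℝ ι × ℝ) (ρ : ℝ) :
    ∫ z, radialBump z • u (x + ρ • z) =
      (∫ z : EuclideanSpace ℝ ι × ℝ, radialBump z) • u x := by
  have hφ : Continuous (radialBump : EuclideanSpace ℝ ι × ℝ → ℝ) :=
    (contDiff_radialBump (n := 0)).continuous
  have hφc : HasCompactSupport (radialBump : EuclideanSpace ℝ ι × ℝ → ℝ) :=
    hasCompactSupport_radialBump
  have hu' : Continuous (fderiv ℝ u) := hu.continuous_fderiv one_ne_zero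
  have hcont : Continuous fun q : ℝ × (EuclideanSpace ℝ ι × ℝ) =>
      fderiv ℝ u (x + q.1 • q.2) q.2 :=
    (hu'.comp (continuous_const.add (continuous_fst.smul continuous_snd))).clm_apply continuous_snd
  have hucont : ∀ t : ℝ, Continuous fun z => u (x + t • z) := fun t => by
    have := hu.continuous
    fun_prop
  -- The average does not depend on the dilation factor, and at factor 0 it is a multiple of u x.
  have hd : ∀ t : ℝ, HasDerivAt (fun t : ℝ => ∫ z, radialBump z • u (x + t • z)) 0 t := by
    intro t
    obtain ⟨M, hM⟩ := ((isCompact_closedBall t 1).prod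
      (isCompact_closedBall (0 : EuclideanSpace ℝ ι × ℝ) 1)).exists_bound_of_continuousOn
        hcont.continuousOn
    have key := (hasDerivAt_integral_of_dominated_loc_of_deriv_le (μ := volume)
      (F := fun (t : ℝ) z => radialBump z • u (x + t • z))
      (F' := fun (t : ℝ) z => radialBump z • fderiv ℝ u (x + t • z) z)
      (bound := fun z => radialBump z * M) (x₀ := t)
      (Metric.closedBall_mem_nhds t one_pos) ?_ ?_ ?_ ?_ ?_ ?_).2
    · convert key using 1
      symm
      -- For t ≠ 0 the dilated solution is used and the factor t cancelled; for t = 0 it is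
      -- constant, and the linear part of u at x serves instead.
      by_cases ht : t = 0
      · have := integral_radialBump_smul_fderiv_eq_zero hB (fderiv ℝ u x).contDiff
          (h.fderiv_const x)
        simp only [ContinuousLinearMap.fderiv] at this
        simpa [ht] using this
      · have h1 : ContDiff ℝ 1 fun z => u (x + t • z) := by fun_prop
        have := integral_radialBump_smul_fderiv_eq_zero hB h1 (h.comp_add_smul hu x t)
        simp only [fderiv_comp_add_smul hu, smul_comm _ t] at this
        rw [integral_smul] at this
        exact (smul_eq_zero.1 this).resolve_left ht
    · exact Eventually.of_forall fun t => (hφ.smul (hucont t)).aestronglyMeasurable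
    · exact integrable_smul_of_hasCompactSupport volume hφ hφc (hucont t)
    · exact (hφ.smul (hcont.comp (Continuous.prodMk_right t))).aestronglyMeasurable
    · refine Eventually.of_forall fun z s hs => ?_
      rw [norm_smul, Real.norm_eq_abs, abs_of_nonneg (radialBump_nonneg z)]
      by_cases hz : z ∈ Metric.closedBall (0 : EuclideanSpace ℝ ι × ℝ) 1
      · exact mul_le_mul_of_nonneg_left (hM (s, z) ⟨hs, hz⟩) (radialBump_nonneg z)
      · simp [radialBump_eq_zero hz]
    · exact (hφ.integrable_of_hasCompactSupport hφc).mul_const M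
    · refine Eventually.of_forall fun z s _ => HasDerivAt.const_smul (radialBump z) ?_
      have h1 : HasDerivAt (fun s : ℝ => x + s • z) z s := by
        simpa using ((hasDerivAt_id s).smul_const z).const_add x
      exact (hu.differentiable one_ne_zero _).hasFDerivAt.comp_hasDerivAt s h1
  have h0 := is_const_of_deriv_eq_zero (fun t => (hd t).differentiableAt)
    (fun t => (hd t).deriv) ρ 0
  rw [h0]
  simp [integral_smul_const]

/-- The mean value property with ρ = -1 writes u as a convolution with a smooth compactly supported
density. -/
theorem SolvesEvolution.contDiff
    (hB : ∀ i j, B i * B j + B j * B i = if i = j then -2 else 0)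
    (hu : ContDiff ℝ 1 u) (h : SolvesEvolution B u) : ContDiff ℝ ∞ u := by
  have hpos := integral_radialBump_pos (E := EuclideanSpace ℝ ι)
  have key : u = fun x => (∫ z : EuclideanSpace ℝ ι × ℝ, radialBump z)⁻¹ •
      convolution radialBump u (ContinuousLinearMap.lsmul ℝ ℝ) volume x := by
    ext x
    have h1 : convolution radialBump u (ContinuousLinearMap.lsmul ℝ ℝ) volume x =
        ∫ z, radialBump z • u (x + (-1 : ℝ) • z) := by
      simp [convolution, sub_eq_add_neg]
    rw [h1, h.integral_radialBump_smul hB hu, smul_smul, inv_mul_cancel₀ hpos.ne', one_smul]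
  rw [key]
  exact contDiff_const.smul (hasCompactSupport_radialBump.contDiff_convolution_left _
    contDiff_radialBump hu.continuous.locallyIntegrable)

/-- Interior estimate for the derivatives of solutions. -/
theorem exists_norm_fderiv_le (v : EuclideanSpace ℝ ι × ℝ) :
    ∃ C : ℝ, 0 ≤ C ∧ ∀ (B : ι → F →L[ℝ] F) (u : EuclideanSpace ℝ ι × ℝ → F),
      (∀ i j, B i * B j + B j * B i = if i = j then -2 else 0) → ContDiff ℝ 2 u →
      SolvesEvolution B u → ∀ (x : EuclideanSpace ℝ ι × ℝ) (ρ M : ℝ), 0 < ρ →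
      (∀ z ∈ Metric.closedBall x ρ, ‖u z‖ ≤ M) → ‖fderiv ℝ u x v‖ ≤ C / ρ * M := by
  set c := ∫ z : EuclideanSpace ℝ ι × ℝ, radialBump z with hc
  have hpos : 0 < c := integral_radialBump_pos
  have hφ1 : ContDiff ℝ 1 (radialBump : EuclideanSpace ℝ ι × ℝ → ℝ) := contDiff_radialBump
  have hφc : HasCompactSupport (radialBump : EuclideanSpace ℝ ι × ℝ → ℝ) :=
    hasCompactSupport_radialBump
  have hφd : Continuous fun z : EuclideanSpace ℝ ι × ℝ => fderiv ℝ radialBump z v :=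
    (hφ1.continuous_fderiv one_ne_zero).clm_apply continuous_const
  -- The constant is the L¹ norm of the v-derivative of the density, divided by its mass.
  refine ⟨c⁻¹ * ∫ z, ‖fderiv ℝ radialBump z v‖,
    mul_nonneg (inv_nonneg.2 hpos.le) (integral_nonneg fun _ => norm_nonneg _), ?_⟩
  intro B u hB hu h x ρ M hρ hM
  have hu1 : ContDiff ℝ 1 u := hu.of_le one_le_two
  have hv1 : ContDiff ℝ 1 fun z => fderiv ℝ u z v :=
    (hu.fderiv_right (m := 1) (by norm_num)).clm_apply contDiff_const
  have hw : ContDiff ℝ 1 fun z => u (x + ρ • z) := by fun_prop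
  have h1 := (h.fderiv_apply hu v).integral_radialBump_smul hB hv1 x ρ
  -- The mean value property holds for ∂ᵥu as well; integration by parts moves the derivative onto
  -- the density, and the chain rule supplies ρ.
  have h2 : ρ • ∫ z, radialBump z • fderiv ℝ u (x + ρ • z) v =
      -∫ z, fderiv ℝ radialBump z v • u (x + ρ • z) := by
    rw [← integral_smul]
    simp only [smul_comm ρ, ← fderiv_comp_add_smul hu1]
    refine integral_smul_fderiv_eq_neg_fderiv_smul_of_integrable ?_ ?_ ?_ ?_ ?_
    · exact integrable_smul_of_hasCompactSupport volume hφd (hφc.fderiv_apply ℝ v) hw.continuous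
    · exact integrable_smul_of_hasCompactSupport volume hφ1.continuous hφc
        ((hw.continuous_fderiv one_ne_zero).clm_apply continuous_const)
    · exact integrable_smul_of_hasCompactSupport volume hφ1.continuous hφc hw.continuous
    · exact fun z _ => hφ1.differentiable one_ne_zero z
    · exact fun z _ => hw.differentiable one_ne_zero z
  have h3 : ‖∫ z, fderiv ℝ radialBump z v • u (x + ρ • z)‖ ≤
      (∫ z : EuclideanSpace ℝ ι × ℝ, ‖fderiv ℝ radialBump z v‖) * M := by
    rw [← integral_mul_const]
    refine norm_integral_le_of_norm_le ((hφd.norm.integrable_of_hasCompactSupport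
      (hφc.fderiv_apply ℝ v).norm).mul_const M) (Eventually.of_forall fun z => ?_)
    rw [norm_smul]
    by_cases hz : z ∈ Metric.closedBall (0 : EuclideanSpace ℝ ι × ℝ) 1
    · refine mul_le_mul_of_nonneg_left (hM _ ?_) (norm_nonneg _)
      rw [mem_closedBall_zero_iff] at hz
      rw [mem_closedBall_iff_norm, add_sub_cancel_left, norm_smul, Real.norm_eq_abs,
        abs_of_pos hρ]
      exact mul_le_of_le_one_right hρ.le hz
    · have : fderiv ℝ radialBump z = 0 := by
        have he : (radialBump : EuclideanSpace ℝ ι × ℝ → ℝ) =ᶠ[𝓝 z] fun _ => 0 := by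
          filter_upwards [Metric.isClosed_closedBall.isOpen_compl.mem_nhds hz] with y hy
          exact radialBump_eq_zero hy
        rw [he.fderiv_eq]; simp
      simp [this]
  rw [h1] at h2
  have h4 : fderiv ℝ u x v = (c⁻¹ * ρ⁻¹) •
      -∫ z, fderiv ℝ radialBump z v • u (x + ρ • z) := by
    rw [← h2, smul_smul, smul_smul, ← hc]
    field_simp
    simp
  rw [h4, norm_smul, norm_neg, Real.norm_eq_abs, abs_of_pos (by positivity)]
  calc _ ≤ c⁻¹ * ρ⁻¹ * ((∫ z : EuclideanSpace ℝ ι × ℝ, ‖fderiv ℝ radialBump z v‖) * M) := by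
        gcongr
    _ = _ := by ring

end MeanValue

end PartialSlice

/-! ### Uniqueness in the Cauchy problem -/

namespace PartialSlice

open Set Filter
open scoped Topology ContDiff Nat

/-- Taylor's remainder estimate with zero Taylor polynomial: the bound on the k-th derivative is
integrated k times from 0 by the mean value inequality. -/
theorem norm_le_of_forall_hasDerivAt_of_eq_zero {F : Type*} [NormedAddCommGroup F]
    [NormedSpace ℝ F] {δ M : ℝ} (k : ℕ) : ∀ {h : ℕ → ℝ → F},
    (∀ j s, HasDerivAt (h j) (h (j + 1) s) s) → (∀ j, h j 0 = 0) →
    (∀ s ∈ Icc 0 δ, ‖h k s‖ ≤ M) → ∀ s ∈ Icc 0 δ, ‖h 0 s‖ ≤ M * (s ^ k / k !) := by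
  induction k with
  | zero => intro h _ _ hM s hs; simpa using hM s hs
  | succ k ih =>
    intro h hd h0 hM s hs
    have h1 := ih (h := fun j => h (j + 1)) (fun j => hd (j + 1)) (fun j => h0 (j + 1)) hM
    refine image_norm_le_of_norm_deriv_right_le_deriv_boundary (f := h 0) (f' := h 1)
      (B := fun s => M * (s ^ (k + 1) / (k + 1)!)) (B' := fun s => M * (s ^ k / k !))
      (fun s _ => (hd 0 s).continuousAt.continuousWithinAt)
      (fun s _ => (hd 0 s).hasDerivWithinAt) (by simp [h0]) (fun s => ?_)
      (fun s hs => h1 s ⟨hs.1, hs.2.le⟩) hs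
    have h2 := ((hasDerivAt_pow (k + 1) s).div_const ((k + 1)! : ℝ)).const_mul M
    refine h2.congr_deriv ?_
    rw [Nat.factorial_succ]
    push_cast
    field_simp

section Uniqueness

variable {ι F : Type*} [Fintype ι] [NormedAddCommGroup F] [NormedSpace ℝ F]

/-- The derivative in the last variable. -/
noncomputable def lastDeriv (u : EuclideanSpace ℝ ι × ℝ → F) : EuclideanSpace ℝ ι × ℝ → F :=
  fun z => fderiv ℝ u z (0, 1)

variable {B : ι → F →L[ℝ] F} {u : EuclideanSpace ℝ ι × ℝ → F}

theorem contDiff_iterate_lastDeriv (hu : ContDiff ℝ ∞ u) (k : ℕ) :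
    ContDiff ℝ ∞ (lastDeriv^[k] u) := by
  induction k with
  | zero => exact hu
  | succ k ih =>
    rw [Function.iterate_succ_apply']
    exact (ih.fderiv_right (m := ∞) (by simp)).clm_apply contDiff_const

variable [DecidableEq ι]

theorem SolvesEvolution.iterate_lastDeriv (hu : ContDiff ℝ ∞ u) (h : SolvesEvolution B u) (k : ℕ) :
    SolvesEvolution B (lastDeriv^[k] u) := by
  induction k with
  | zero => exact h
  | succ k ih =>
    rw [Function.iterate_succ_apply']
    exact ih.fderiv_apply ((contDiff_iterate_lastDeriv hu k).of_le
      (WithTop.coe_le_coe.2 (le_top : (2 : ℕ∞) ≤ ⊤))) _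

/-- Tangential derivatives vanish on r = 0 along with u, and the system expresses the normal
derivative through them. Since r-derivatives are again solutions, this iterates to all orders. -/
theorem SolvesEvolution.lastDeriv_eq_zero (hu : Differentiable ℝ u) (h : SolvesEvolution B u)
    (h0 : ∀ x, u (x, 0) = 0) (x : EuclideanSpace ℝ ι) : lastDeriv u (x, 0) = 0 := by
  rw [lastDeriv, h]
  refine Finset.sum_eq_zero fun i _ => ?_
  have h1 : HasFDerivAt (fun x : EuclideanSpace ℝ ι => (x, (0 : ℝ)))
      (ContinuousLinearMap.inl ℝ _ ℝ) x := hasFDerivAt_prodMk_left x 0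
  have h2 := (hu (x, 0)).hasFDerivAt.comp x h1
  have h3 : u ∘ (fun x : EuclideanSpace ℝ ι => (x, (0 : ℝ))) = fun _ => 0 := funext h0
  rw [h3] at h2
  have h4 := DFunLike.congr_fun (h2.unique (hasFDerivAt_const 0 x)) (EuclideanSpace.single i 1)
  have h5 : fderiv ℝ u (x, 0) (EuclideanSpace.single i 1, 0) = 0 := by simpa using h4
  rw [h5, map_zero]

theorem SolvesEvolution.iterate_lastDeriv_eq_zero (hu : ContDiff ℝ ∞ u)
    (h : SolvesEvolution B u) (h0 : ∀ x, u (x, 0) = 0) (k : ℕ) (x : EuclideanSpace ℝ ι) :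
    lastDeriv^[k] u (x, 0) = 0 := by
  induction k generalizing x with
  | zero => exact h0 x
  | succ k ih =>
    rw [Function.iterate_succ_apply']
    exact (h.iterate_lastDeriv hu k).lastDeriv_eq_zero
      ((contDiff_iterate_lastDeriv hu k).differentiable (by simp)) ih x

variable [CompleteSpace F]

variable (ι F) in
-- The interior estimate is used k times, each time giving up a margin ρ of the ball; C is
-- independent of B, u and k.
theorem exists_norm_iterate_lastDeriv_le :
    ∃ C : ℝ, 0 ≤ C ∧ ∀ (B : ι → F →L[ℝ] F) (u : EuclideanSpace ℝ ι × ℝ → F),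
      (∀ i j, B i * B j + B j * B i = if i = j then -2 else 0) → ContDiff ℝ ∞ u →
      SolvesEvolution B u → ∀ (k : ℕ) (x : EuclideanSpace ℝ ι × ℝ) (ρ M : ℝ), 0 < ρ →
      (∀ z ∈ Metric.closedBall x (k * ρ), ‖u z‖ ≤ M) →
      ‖lastDeriv^[k] u x‖ ≤ (C / ρ) ^ k * M := by
  obtain ⟨C, hC, H⟩ := exists_norm_fderiv_le (F := F) ((0 : EuclideanSpace ℝ ι), (1 : ℝ))
  refine ⟨C, hC, fun B u hB hu h k => ?_⟩
  induction k generalizing u with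
  | zero => intro x ρ M _ hM; simpa using hM x (by simp)
  | succ k ih =>
    intro x ρ M hρ hM
    rw [Function.iterate_succ_apply, pow_succ, mul_assoc]
    refine ih (lastDeriv u) (contDiff_iterate_lastDeriv hu 1) (h.iterate_lastDeriv hu 1) x ρ _ hρ
      fun y hy => ?_
    refine H B u hB (hu.of_le (WithTop.coe_le_coe.2 (le_top : (2 : ℕ∞) ≤ ⊤))) h y ρ M hρ
      fun z hz => hM z ?_
    rw [Metric.mem_closedBall] at *
    calc dist z x ≤ dist z y + dist y x := dist_triangle _ _ _
      _ ≤ ρ + k * ρ := add_le_add hz hy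
      _ = _ := by push_cast; ring

variable (ι F) in
/-- Solutions with vanishing Cauchy data vanish in a slab of universal thickness. -/
theorem exists_pos_forall_eq_zero :
    ∃ δ : ℝ, 0 < δ ∧ ∀ (B : ι → F →L[ℝ] F) (u : EuclideanSpace ℝ ι × ℝ → F),
      (∀ i j, B i * B j + B j * B i = if i = j then -2 else 0) → ContDiff ℝ ∞ u →
      SolvesEvolution B u → (∀ x, u (x, 0) = 0) → ∀ x, ∀ s ∈ Icc 0 δ, u (x, s) = 0 := by
  obtain ⟨C, hC, H⟩ := exists_norm_iterate_lastDeriv_le ι F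
  have he : 1 ≤ Real.exp 1 := Real.one_le_exp zero_le_one
  -- Margin ρ = 1/k bounds the k-th r-derivative by (Ck)^k M, and k^k / k! ≤ e^k, so the Taylor
  -- bound is M (C e s)^k. This δ makes C e s ≤ 1/2; using C + 1 covers C = 0 and gives δ ≤ 1.
  refine ⟨1 / (2 * (C + 1) * Real.exp 1), by positivity, fun B u hB hu h h0 x s hs => ?_⟩
  have hδ : 1 / (2 * (C + 1) * Real.exp 1) ≤ 1 := by
    rw [div_le_one (by positivity)]
    nlinarith
  -- Radius 2 allows for a height t ≤ δ ≤ 1 and a total margin k · (1/k) = 1. M depends on u and x,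
  -- but δ does not.
  obtain ⟨M, hM⟩ := (isCompact_closedBall (x, (0 : ℝ)) 2).exists_bound_of_continuousOn
    hu.continuous.continuousOn
  have hM0 : 0 ≤ M := (norm_nonneg _).trans (hM (x, 0) (by simp))
  have hb : ∀ k : ℕ, 1 ≤ k → ∀ t ∈ Icc 0 (1 / (2 * (C + 1) * Real.exp 1)),
      ‖lastDeriv^[k] u (x, t)‖ ≤ (C * k) ^ k * M := by
    intro k hk t ht
    have hk' : (0 : ℝ) < k := by exact_mod_cast hk
    have := H B u hB hu h k (x, t) (1 / k) M (by positivity) fun z hz => hM z ?_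
    · simpa using this
    · rw [mul_one_div_cancel hk'.ne', Metric.mem_closedBall] at hz
      have hxt : dist (x, t) (x, (0 : ℝ)) ≤ 1 := by
        simpa [Prod.dist_eq, abs_of_nonneg ht.1] using ht.2.trans hδ
      rw [Metric.mem_closedBall]
      linarith [dist_triangle z (x, t) (x, 0)]
  have hbound : ∀ k : ℕ, ‖u (x, s)‖ ≤ M * (1 / 2) ^ (k + 1) := by
    intro k
    have h1 := norm_le_of_forall_hasDerivAt_of_eq_zero (k + 1)
      (h := fun j t => lastDeriv^[j] u (x, t)) (fun j t => ?_)
      (fun j => h.iterate_lastDeriv_eq_zero hu h0 j x) (hb (k + 1) (by simp)) s hs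
    · refine h1.trans ?_
      have h2 : ((k + 1 : ℕ) : ℝ) ^ (k + 1) / (k + 1)! ≤ Real.exp 1 ^ (k + 1) := by
        rw [← Real.exp_nat_mul, mul_one]
        exact Real.pow_div_factorial_le_exp _ (Nat.cast_nonneg _) _
      have h3 : C * Real.exp 1 * s ≤ 1 / 2 := by
        have : s * (2 * (C + 1) * Real.exp 1) ≤ 1 := by
          have := hs.2
          rwa [le_div_iff₀ (by positivity)] at this
        nlinarith [mul_nonneg hs.1 (Real.exp_pos 1).le]
      calc (C * ((k + 1 : ℕ) : ℝ)) ^ (k + 1) * M * (s ^ (k + 1) / (k + 1)!)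
          = M * ((C * s) ^ (k + 1) * (((k + 1 : ℕ) : ℝ) ^ (k + 1) / (k + 1)!)) := by ring
        _ ≤ M * ((C * s) ^ (k + 1) * Real.exp 1 ^ (k + 1)) := by
          have := hs.1
          gcongr
        _ = M * (C * Real.exp 1 * s) ^ (k + 1) := by ring
        _ ≤ M * (1 / 2) ^ (k + 1) := by
          have := hs.1
          gcongr
    · have h2 : HasDerivAt (fun t : ℝ => (x, t)) ((0 : EuclideanSpace ℝ ι), (1 : ℝ)) t :=
        (hasDerivAt_const t x).prodMk (hasDerivAt_id t)
      have h3 := ((contDiff_iterate_lastDeriv hu j).differentiable (by simp)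
        (x, t)).hasFDerivAt.comp_hasDerivAt t h2
      simp only [Function.iterate_succ_apply']
      exact h3
  have hlim : Tendsto (fun k : ℕ => M * (1 / 2 : ℝ) ^ (k + 1)) atTop (𝓝 (M * 0)) :=
    ((tendsto_pow_atTop_nhds_zero_of_lt_one (by norm_num) (by norm_num)).comp
      (tendsto_add_atTop_nat 1)).const_mul M
  rw [mul_zero] at hlim
  exact norm_le_zero_iff.1 (ge_of_tendsto' hlim hbound)

/-- As the slab thickness is universal, the argument restarts at each height kδ with the zero data
found at the top of the previous slab. -/
theorem SolvesEvolution.eq_zero_of_nonneg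
    (hB : ∀ i j, B i * B j + B j * B i = if i = j then -2 else 0)
    (hu : ContDiff ℝ ∞ u) (h : SolvesEvolution B u) (h0 : ∀ x, u (x, 0) = 0)
    (x : EuclideanSpace ℝ ι) {s : ℝ} (hs : 0 ≤ s) : u (x, s) = 0 := by
  obtain ⟨δ, hδ, H⟩ := exists_pos_forall_eq_zero ι F
  have key : ∀ (k : ℕ) (x : EuclideanSpace ℝ ι), ∀ t ∈ Icc 0 δ, u (x, k * δ + t) = 0 := by
    intro k
    induction k with
    | zero => simpa using H B u hB hu h h0
    | succ k ih =>
      have h1 := h.comp_add_smul (hu.of_le (by simp)) (0, (k + 1 : ℕ) * δ) 1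
      have h2 : ContDiff ℝ ∞ fun z => u ((0, (k + 1 : ℕ) * δ) + (1 : ℝ) • z) := by fun_prop
      have h3 := H B _ hB h2 h1 fun x => by
        have := ih x δ ⟨hδ.le, le_rfl⟩
        simpa [add_mul] using this
      intro x t ht
      simpa using h3 x t ht
  have h1 := Nat.floor_le (div_nonneg hs hδ.le)
  have h2 := Nat.lt_floor_add_one (s / δ)
  rw [le_div_iff₀ hδ] at h1
  rw [div_lt_iff₀ hδ] at h2
  have := key ⌊s / δ⌋₊ x (s - ⌊s / δ⌋₊ * δ) ⟨by linarith, by linarith⟩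
  simpa using this

/-- Uniqueness in the Cauchy problem for the system `∂_r u = ∑ᵢ Bᵢ ∂ᵢ u`. -/
theorem SolvesEvolution.eq_zero
    (hB : ∀ i j, B i * B j + B j * B i = if i = j then -2 else 0)
    (hu : ContDiff ℝ 1 u) (h : SolvesEvolution B u) (h0 : ∀ x, u (x, 0) = 0) : u = 0 := by
  have hu' := h.contDiff hB hu
  ext ⟨x, s⟩
  rcases le_total 0 s with hs | hs
  · exact h.eq_zero_of_nonneg hB hu' h0 x hs
  -- Reflecting r changes the sign of every Bᵢ, which preserves the quadratic relations.
  · let R : EuclideanSpace ℝ ι × ℝ →L[ℝ] EuclideanSpace ℝ ι × ℝ :=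
      (ContinuousLinearMap.fst ℝ _ ℝ).prod (-ContinuousLinearMap.snd ℝ _ ℝ)
    have hR : ∀ z a, fderiv ℝ (fun z => u (R z)) z a = fderiv ℝ u (R z) (R a) := by
      intro z a
      have h1 := ((hu.differentiable one_ne_zero (R z)).hasFDerivAt.comp z R.hasFDerivAt).fderiv
      have h2 : fderiv ℝ (fun z => u (R z)) z = (fderiv ℝ u (R z)).comp R := h1
      rw [h2]; rfl
    have hS : SolvesEvolution (fun i => -B i) fun z => u (R z) := by
      intro z
      have e1 : R (0, 1) = -(0, 1) := by simp [R]
      have e2 : ∀ i, R (EuclideanSpace.single i 1, 0) = (EuclideanSpace.single i 1, 0) := by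
        intro i; simp [R]
      simp only [hR, e1, e2, map_neg, h (R z), _root_.neg_apply, Finset.sum_neg_distrib]
    have := hS.eq_zero_of_nonneg (by simpa using hB) (hu'.comp R.contDiff)
      (fun x => by simpa [R] using h0 x) x (neg_nonneg.2 hs)
    simpa [R] using this

end Uniqueness

end PartialSlice

/-! ### Cauchy estimates and termwise differentiation -/

namespace PartialSlice

open Set Filter
open scoped Topology ContDiff Nat NNReal ENNReal

/-- Cauchy estimates, uniform on balls, for a function given by an everywhere convergent power
series. -/
theorem exists_norm_iteratedFDeriv_le {E F : Type*} [NormedAddCommGroup E] [NormedSpace ℝ E]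
    [NormedAddCommGroup F] [NormedSpace ℝ F] [CompleteSpace F] {f : E → F}
    {P : FormalMultilinearSeries ℝ E F} (hf : HasFPowerSeriesOnBall f P 0 ⊤) (R ρ : ℝ≥0) :
    ∃ C : ℝ, 0 ≤ C ∧ ∀ (m : ℕ) (x : E), ‖x‖ ≤ ρ →
      ‖iteratedFDeriv ℝ m f x‖ * R ^ m ≤ C * m ! := by
  have hr : P.radius = ⊤ := top_le_iff.1 hf.r_le
  -- The infinite radius admits ρ + R. The total of this re-expansion series is the constant C, and
  -- it dominates the part belonging to each m.
  have hsum := P.changeOriginSeries_summable_aux₁ (r := ρ) (r' := R)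
    (by rw [hr]; exact ENNReal.add_lt_top.2 ⟨ENNReal.coe_lt_top, ENNReal.coe_lt_top⟩)
  obtain ⟨h1, h2⟩ := NNReal.summable_sigma.1 hsum
  refine ⟨_, NNReal.coe_nonneg (∑' k, ∑' s : Σ l : ℕ, { s : Finset (Fin (k + l)) // s.card = l },
    ‖P (k + s.1)‖₊ * ρ ^ s.1 * R ^ k), fun m x hx => ?_⟩
  have hxρ : ‖x‖₊ ≤ ρ := hx
  have hb : ‖P.changeOrigin x m‖₊ * R ^ m ≤
      ∑' k, ∑' s : Σ l : ℕ, { s : Finset (Fin (k + l)) // s.card = l },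
        ‖P (k + s.1)‖₊ * ρ ^ s.1 * R ^ k := by
    calc ‖P.changeOrigin x m‖₊ * R ^ m
        ≤ (∑' s : Σ l : ℕ, { s : Finset (Fin (m + l)) // s.card = l },
            ‖P (m + s.1)‖₊ * ρ ^ s.1) * R ^ m := by
          gcongr
          refine (P.nnnorm_changeOrigin_le m (by rw [hr]; exact ENNReal.coe_lt_top)).trans ?_
          refine Summable.tsum_le_tsum (fun s => by gcongr) ?_ ?_
          · exact P.changeOriginSeries_summable_aux₂ (by rw [hr]; exact ENNReal.coe_lt_top) m
          · exact P.changeOriginSeries_summable_aux₂ (by rw [hr]; exact ENNReal.coe_lt_top) m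
      _ = ∑' s : Σ l : ℕ, { s : Finset (Fin (m + l)) // s.card = l },
            ‖P (m + s.1)‖₊ * ρ ^ s.1 * R ^ m := (NNReal.tsum_mul_right _ _).symm
      _ ≤ _ := h2.le_tsum' m
  have hx' := hf.changeOrigin (y := x) ENNReal.coe_lt_top
  rw [zero_add] at hx'
  -- The m-th derivative is the sum of the m-th coefficient over all m! permutations of its
  -- arguments.
  have hD : ‖iteratedFDeriv ℝ m f x‖ ≤ m ! * ‖P.changeOrigin x m‖ := by
    refine ContinuousMultilinearMap.opNorm_le_bound (by positivity) fun v => ?_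
    rw [hx'.iteratedFDeriv_eq_sum_of_completeSpace]
    refine (norm_sum_le _ _).trans ?_
    have : ∀ σ ∈ (Finset.univ : Finset (Equiv.Perm (Fin m))),
        ‖P.changeOrigin x m fun i => v (σ i)‖ ≤ ‖P.changeOrigin x m‖ * ∏ i, ‖v i‖ := by
      intro σ _
      refine (ContinuousMultilinearMap.le_opNorm _ _).trans_eq ?_
      rw [Equiv.prod_comp σ fun i => ‖v i‖]
    refine (Finset.sum_le_sum this).trans_eq ?_
    rw [Finset.sum_const, Finset.card_univ, Fintype.card_perm, Fintype.card_fin, nsmul_eq_mul,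
      mul_assoc]
  calc ‖iteratedFDeriv ℝ m f x‖ * R ^ m ≤ m ! * ‖P.changeOrigin x m‖ * R ^ m := by gcongr
    _ = (‖P.changeOrigin x m‖ * R ^ m) * m ! := by ring
    _ ≤ _ := by
      gcongr
      exact_mod_cast hb

/-- Termwise differentiation of a series whose derivatives are summably bounded on balls. -/
theorem contDiff_one_tsum_of_bound_on_balls {V F : Type*} [NormedAddCommGroup V] [NormedSpace ℝ V]
    [NormedAddCommGroup F] [NormedSpace ℝ F] [CompleteSpace F] {f : ℕ → V → F}
    (hf : ∀ n, ContDiff ℝ 1 (f n)) (h0 : Summable fun n => f n 0)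
    (hb : ∀ ρ : ℝ, 1 ≤ ρ → ∃ c : ℕ → ℝ, Summable c ∧
      ∀ n z, ‖z‖ < ρ → ‖fderiv ℝ (f n) z‖ ≤ c n) :
    ContDiff ℝ 1 (fun z => ∑' n, f n z) ∧ ∀ z, Summable (fun n => fderiv ℝ (f n) z) ∧
      HasFDerivAt (fun z => ∑' n, f n z) (∑' n, fderiv ℝ (f n) z) z := by
  have hd : ∀ z, HasFDerivAt (fun z => ∑' n, f n z) (∑' n, fderiv ℝ (f n) z) z := by
    intro z
    obtain ⟨c, hc, hbc⟩ := hb (‖z‖ + 1) (by linarith [norm_nonneg z])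
    refine hasFDerivAt_tsum_of_isPreconnected hc (Metric.isOpen_ball (x := (0 : V)))
      (convex_ball (0 : V) (‖z‖ + 1)).isPreconnected
      (fun n x _ => ((hf n).differentiable one_ne_zero x).hasFDerivAt)
      (fun n x hx => hbc n x (mem_ball_zero_iff.1 hx))
      (Metric.mem_ball_self (by linarith [norm_nonneg z])) h0 ?_
    rw [mem_ball_zero_iff]; linarith
  refine ⟨contDiff_one_iff_fderiv.2 ⟨fun z => (hd z).differentiableAt, ?_⟩, fun z => ⟨?_, hd z⟩⟩
  · rw [continuous_iff_continuousAt]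
    intro z
    obtain ⟨c, hc, hbc⟩ := hb (‖z‖ + 1) (by linarith [norm_nonneg z])
    have h1 : ContinuousOn (fun z => ∑' n, fderiv ℝ (f n) z) (Metric.ball 0 (‖z‖ + 1)) :=
      continuousOn_tsum (fun n => ((hf n).continuous_fderiv one_ne_zero).continuousOn) hc
        fun n x hx => hbc n x (mem_ball_zero_iff.1 hx)
    have h2 : fderiv ℝ (fun z => ∑' n, f n z) = fun z => ∑' n, fderiv ℝ (f n) z :=
      funext fun z => (hd z).fderiv
    rw [h2]
    refine h1.continuousAt (Metric.isOpen_ball.mem_nhds ?_)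
    rw [mem_ball_zero_iff]; linarith
  · obtain ⟨c, hc, hbc⟩ := hb (‖z‖ + 1) (by linarith [norm_nonneg z])
    exact .of_norm_bounded hc fun n => hbc n z (by linarith)

/-! ### Existence through the exponential series -/

section Existence

variable {ι F : Type*} [Fintype ι] [DecidableEq ι] [NormedAddCommGroup F] [NormedSpace ℝ F]

/-- The first order operator `∑ᵢ Bᵢ ∂ᵢ` on functions on `ℝ^ι`. -/
noncomputable def firstOrderOp (B : ι → F →L[ℝ] F) (g : EuclideanSpace ℝ ι → F) :
    EuclideanSpace ℝ ι → F :=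
  fun x => ∑ i, B i (fderiv ℝ g x (EuclideanSpace.single i 1))

/-- The symbol of `firstOrderOp`. -/
noncomputable def symbolMap (B : ι → F →L[ℝ] F) : (EuclideanSpace ℝ ι →L[ℝ] F) →L[ℝ] F :=
  ∑ i, (B i).comp (ContinuousLinearMap.apply ℝ F (EuclideanSpace.single i 1))

variable (B : ι → F →L[ℝ] F) {f g : EuclideanSpace ℝ ι → F}

theorem firstOrderOp_eq (g : EuclideanSpace ℝ ι → F) :
    firstOrderOp B g = symbolMap B ∘ fderiv ℝ g := by
  ext x; simp [firstOrderOp, symbolMap]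

theorem contDiff_iterate_firstOrderOp (hg : ContDiff ℝ ∞ g) (m : ℕ) :
    ContDiff ℝ ∞ ((firstOrderOp B)^[m] g) := by
  induction m with
  | zero => exact hg
  | succ m ih =>
    rw [Function.iterate_succ_apply', firstOrderOp_eq]
    exact (symbolMap B).contDiff.comp (ih.fderiv_right (m := ∞) (by simp))

/-- Each application of the operator costs one derivative and one factor of the norm of its constant
symbol. -/
theorem norm_iteratedFDeriv_iterate_firstOrderOp_le (hg : ContDiff ℝ ∞ g) (m j : ℕ)
    (x : EuclideanSpace ℝ ι) :
    ‖iteratedFDeriv ℝ j ((firstOrderOp B)^[m] g) x‖ ≤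
      ‖symbolMap B‖ ^ m * ‖iteratedFDeriv ℝ (j + m) g x‖ := by
  induction m generalizing j with
  | zero => simp
  | succ m ih =>
    have hc := contDiff_iterate_firstOrderOp B hg m
    rw [Function.iterate_succ_apply', firstOrderOp_eq]
    refine ((symbolMap B).norm_iteratedFDeriv_comp_left (N := ∞)
      (hc.fderiv_right (m := ∞) (by simp)).contDiffAt (WithTop.coe_le_coe.2 le_top)).trans ?_
    rw [norm_iteratedFDeriv_fderiv, pow_succ', mul_assoc]
    refine mul_le_mul_of_nonneg_left ((ih (j + 1)).trans_eq ?_) (norm_nonneg _)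
    rw [add_right_comm, add_assoc]

/-- The terms of the exponential series `exp(r ∑ᵢ Bᵢ ∂ᵢ) f`. -/
noncomputable def expTerm (f : EuclideanSpace ℝ ι → F) (m : ℕ)
    (z : EuclideanSpace ℝ ι × ℝ) : F :=
  (z.2 ^ m / m !) • (firstOrderOp B)^[m] f z.1

/-- At m = 0 the truncated exponent m - 1 is harmless because of the factor m. -/
theorem hasFDerivAt_expTerm (hf : ContDiff ℝ ∞ f) (m : ℕ) (z : EuclideanSpace ℝ ι × ℝ) :
    HasFDerivAt (expTerm B f m)
      ((z.2 ^ m / m !) • (fderiv ℝ ((firstOrderOp B)^[m] f) z.1).comp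
          (ContinuousLinearMap.fst ℝ _ ℝ) +
        ((m * z.2 ^ (m - 1) / m !) • ContinuousLinearMap.snd ℝ _ ℝ).smulRight
          ((firstOrderOp B)^[m] f z.1)) z := by
  have h1 : HasFDerivAt (fun z : EuclideanSpace ℝ ι × ℝ => z.2 ^ m / m !)
      ((m * z.2 ^ (m - 1) / m !) • ContinuousLinearMap.snd ℝ (EuclideanSpace ℝ ι) ℝ) z :=
    ((hasDerivAt_pow m z.2).div_const (m ! : ℝ)).comp_hasFDerivAt z hasFDerivAt_snd
  have h2 : HasFDerivAt (fun z : EuclideanSpace ℝ ι × ℝ => (firstOrderOp B)^[m] f z.1)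
      ((fderiv ℝ ((firstOrderOp B)^[m] f) z.1).comp (ContinuousLinearMap.fst ℝ _ ℝ)) z :=
    HasFDerivAt.comp (g := (firstOrderOp B)^[m] f) z
      (((contDiff_iterate_firstOrderOp B hf m).differentiable (by simp) z.1).hasFDerivAt)
      hasFDerivAt_fst
  exact h1.smul h2

theorem contDiff_expTerm (hf : ContDiff ℝ ∞ f) (m : ℕ) : ContDiff ℝ ∞ (expTerm B f m) :=
  ((contDiff_snd.pow m).div_const _).smul
    ((contDiff_iterate_firstOrderOp B hf m).comp contDiff_fst)

theorem tsum_expTerm_zero (x : EuclideanSpace ℝ ι) : ∑' m, expTerm B f m (x, 0) = f x := by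
  rw [tsum_eq_single 0 fun m hm => by simp [expTerm, hm]]
  simp [expTerm]

variable [CompleteSpace F] {P : FormalMultilinearSeries ℝ (EuclideanSpace ℝ ι) F}

theorem summable_succ_mul_half_pow (C : ℝ) :
    Summable fun m : ℕ => C * ((m + 1) * (1 / 2 : ℝ) ^ m) := by
  refine Summable.mul_left C ?_
  have h1 := summable_pow_mul_geometric_of_norm_lt_one (R := ℝ) 1 (r := 1 / 2) (by norm_num)
  have h2 := summable_pow_mul_geometric_of_norm_lt_one (R := ℝ) 0 (r := 1 / 2) (by norm_num)
  exact (h1.add h2).congr fun m => by simp; ring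

/-- The m! of the Cauchy estimates cancels that of the series. The three bounds concern a term, its
x-derivative and its r-derivative; a derivative costs at most a factor m + 1. -/
theorem exists_bound_iterate_firstOrderOp (hf : HasFPowerSeriesOnBall f P 0 ⊤) {ρ : ℝ}
    (hρ : 1 ≤ ρ) :
    ∃ C : ℝ, 0 ≤ C ∧ ∀ (m : ℕ) (x : EuclideanSpace ℝ ι) (r : ℝ), ‖x‖ < ρ → |r| < ρ →
      ‖(r ^ m / m !) • (firstOrderOp B)^[m] f x‖ ≤ C * (1 / 2) ^ m ∧
      ‖(r ^ m / m !) • fderiv ℝ ((firstOrderOp B)^[m] f) x‖ ≤ C * ((m + 1) * (1 / 2) ^ m) ∧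
      ‖(m * r ^ (m - 1) / m ! : ℝ)‖ * ‖(firstOrderOp B)^[m] f x‖ ≤
        C * ((m + 1) * (1 / 2) ^ m) := by
  have hfs : ContDiff ℝ ∞ f := by
    have : AnalyticOnNhd ℝ f univ := by simpa using hf.analyticOnNhd
    exact this.contDiff
  set b := ‖symbolMap B‖
  have hb0 : 0 ≤ b := norm_nonneg (symbolMap B)
  -- Chosen so that bρ/R ≤ 1/2, which is the ratio of the geometric bound, and R ≥ 1, which lets R^m
  -- be bounded by R^(j+m).
  set R : ℝ := 2 * (b + 1) * ρ with hR
  have hR1 : 1 ≤ R := by rw [hR]; nlinarith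
  obtain ⟨C, hC, H⟩ := exists_norm_iteratedFDeriv_le hf ⟨R, by positivity⟩ ⟨ρ, by positivity⟩
  change ∀ (m : ℕ) (x : EuclideanSpace ℝ ι), ‖x‖ ≤ ρ →
    ‖iteratedFDeriv ℝ m f x‖ * R ^ m ≤ C * m ! at H
  have hq : b * ρ / R ≤ 1 / 2 := by
    rw [div_le_div_iff₀ (by positivity) two_pos, hR]; nlinarith
  have hA : ∀ (m j : ℕ) (x : EuclideanSpace ℝ ι), ‖x‖ < ρ →
      ρ ^ m * ‖iteratedFDeriv ℝ j ((firstOrderOp B)^[m] f) x‖ ≤ C * (j + m)! * (1 / 2) ^ m := by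
    intro m j x hx
    have h1 := norm_iteratedFDeriv_iterate_firstOrderOp_le B hfs m j x
    have h2 := H (j + m) x hx.le
    have h3 : ‖iteratedFDeriv ℝ (j + m) f x‖ ≤ C * (j + m)! / R ^ m := by
      rw [le_div_iff₀ (by positivity)]
      refine le_trans ?_ h2
      gcongr
      omega
    calc ρ ^ m * ‖iteratedFDeriv ℝ j ((firstOrderOp B)^[m] f) x‖
        ≤ ρ ^ m * (b ^ m * (C * (j + m)! / R ^ m)) := by gcongr; exact h1.trans (by gcongr)
      _ = C * (j + m)! * (b * ρ / R) ^ m := by rw [div_pow, mul_pow]; ring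
      _ ≤ _ := by gcongr
  have h0 : ∀ (m : ℕ) (x : EuclideanSpace ℝ ι), ‖x‖ < ρ →
      ρ ^ m * ‖(firstOrderOp B)^[m] f x‖ ≤ C * m ! * (1 / 2) ^ m := by
    intro m x hx
    simpa [norm_iteratedFDeriv_zero] using hA m 0 x hx
  have hpow : ∀ (m : ℕ) (r : ℝ), |r| < ρ → |r| ^ m ≤ ρ ^ m := fun m r hr => by gcongr
  refine ⟨C, hC, fun m x r hx hr => ⟨?_, ?_, ?_⟩⟩
  · rw [norm_smul, norm_div, norm_pow, Real.norm_eq_abs, Real.norm_natCast, div_mul_eq_mul_div,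
      div_le_iff₀ (by positivity)]
    calc _ ≤ ρ ^ m * ‖(firstOrderOp B)^[m] f x‖ := by gcongr
      _ ≤ _ := h0 m x hx
      _ = _ := by ring
  · rw [norm_smul, norm_div, norm_pow, Real.norm_eq_abs, Real.norm_natCast, div_mul_eq_mul_div,
      div_le_iff₀ (by positivity)]
    calc _ ≤ ρ ^ m * ‖fderiv ℝ ((firstOrderOp B)^[m] f) x‖ := by gcongr
      _ ≤ C * (1 + m)! * (1 / 2) ^ m := by simpa [norm_iteratedFDeriv_one] using hA m 1 x hx
      _ = _ := by rw [add_comm 1 m, Nat.factorial_succ]; push_cast; ring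
  · rw [norm_div, norm_mul, norm_pow, Real.norm_eq_abs r, Real.norm_natCast, Real.norm_natCast,
      div_mul_eq_mul_div, div_le_iff₀ (by positivity)]
    calc _ ≤ m * ρ ^ m * ‖(firstOrderOp B)^[m] f x‖ := by
          gcongr
          calc |r| ^ (m - 1) ≤ ρ ^ (m - 1) := hpow _ _ hr
            _ ≤ ρ ^ m := pow_le_pow_right₀ hρ (Nat.sub_le _ _)
      _ = m * (ρ ^ m * ‖(firstOrderOp B)^[m] f x‖) := by ring
      _ ≤ (m + 1) * (C * m ! * (1 / 2) ^ m) := 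
        mul_le_mul (by linarith) (h0 m x hx) (by positivity) (by positivity)
      _ = _ := by ring

theorem summable_expTerm (hf : HasFPowerSeriesOnBall f P 0 ⊤) (z : EuclideanSpace ℝ ι × ℝ) :
    Summable fun m => expTerm B f m z := by
  obtain ⟨C, -, H⟩ := exists_bound_iterate_firstOrderOp B hf (ρ := ‖z‖ + 1)
    (by linarith [norm_nonneg z])
  refine .of_norm_bounded ((summable_geometric_of_lt_one (r := 1 / 2) (by norm_num)
    (by norm_num)).mul_left C) fun m => (H m z.1 z.2 ?_ ?_).1
  · linarith [norm_fst_le z]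
  · linarith [norm_snd_le z, Real.norm_eq_abs z.2]

/-- The r-derivative of term m + 1 is ∑ Bᵢ ∂ᵢ of term m, so the two differentiated series agree
after a shift of index. -/
theorem contDiff_and_solvesEvolution_tsum_expTerm (hf : HasFPowerSeriesOnBall f P 0 ⊤) :
    ContDiff ℝ 1 (fun z => ∑' m, expTerm B f m z) ∧
      SolvesEvolution B fun z => ∑' m, expTerm B f m z := by
  have hfs : ContDiff ℝ ∞ f := by
    have : AnalyticOnNhd ℝ f univ := by simpa using hf.analyticOnNhd
    exact this.contDiff
  obtain ⟨h1, h2⟩ := contDiff_one_tsum_of_bound_on_balls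
    (fun m => (contDiff_expTerm B hfs m).of_le (by simp)) (summable_expTerm B hf 0) (by
      intro ρ hρ
      obtain ⟨C, -, H⟩ := exists_bound_iterate_firstOrderOp B hf hρ
      refine ⟨fun m => C * ((m + 1) * (1 / 2 : ℝ) ^ m) + C * ((m + 1) * (1 / 2 : ℝ) ^ m),
        (summable_succ_mul_half_pow C).add (summable_succ_mul_half_pow C), fun m z hz => ?_⟩
      obtain ⟨-, Ha, Hb⟩ := H m z.1 z.2 ((norm_fst_le z).trans_lt hz)
        ((Real.norm_eq_abs z.2 ▸ norm_snd_le z).trans_lt hz)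
      rw [(hasFDerivAt_expTerm B hfs m z).fderiv]
      refine (norm_add_le _ _).trans (add_le_add (le_trans ?_ Ha) (le_trans ?_ Hb))
      · rw [← ContinuousLinearMap.smul_comp]
        refine (ContinuousLinearMap.opNorm_comp_le _ _).trans ?_
        exact mul_le_of_le_one_right (norm_nonneg _) (ContinuousLinearMap.norm_fst_le _ _ _)
      · rw [ContinuousLinearMap.norm_smulRight_apply, norm_smul]
        gcongr
        exact mul_le_of_le_one_right (norm_nonneg _) (ContinuousLinearMap.norm_snd_le _ _ _))
  refine ⟨h1, fun z => ?_⟩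
  have hv : ∀ v, HasSum (fun m => fderiv ℝ (expTerm B f m) z v)
      (fderiv ℝ (fun z => ∑' m, expTerm B f m z) z v) := by
    intro v
    rw [(h2 z).2.fderiv]
    exact (ContinuousLinearMap.apply ℝ F v).hasSum (h2 z).1.hasSum
  have hr := hv (0, 1)
  have hx : HasSum (fun m => ∑ i, B i (fderiv ℝ (expTerm B f m) z (EuclideanSpace.single i 1, 0)))
      (∑ i, B i (fderiv ℝ (fun z => ∑' m, expTerm B f m z) z (EuclideanSpace.single i 1, 0))) :=
    hasSum_sum fun i _ => (B i).hasSum (hv _)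
  have e1 : ∀ m, fderiv ℝ (expTerm B f (m + 1)) z (0, 1) =
      (z.2 ^ m / m !) • (firstOrderOp B)^[m + 1] f z.1 := by
    intro m
    rw [(hasFDerivAt_expTerm B hfs (m + 1) z).fderiv]
    have : ((m + 1 : ℕ) * z.2 ^ m / (m + 1)! : ℝ) = z.2 ^ m / m ! := by
      rw [Nat.factorial_succ]; push_cast; field_simp
    simp [← this]
  have e2 : ∀ m, ∑ i, B i (fderiv ℝ (expTerm B f m) z (EuclideanSpace.single i 1, 0)) =
      (z.2 ^ m / m !) • (firstOrderOp B)^[m + 1] f z.1 := by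
    intro m
    rw [(hasFDerivAt_expTerm B hfs m z).fderiv, Function.iterate_succ_apply', firstOrderOp,
      Finset.smul_sum]
    simp
  -- The term of index 0 does not depend on r, so the shift loses nothing.
  have e0 : fderiv ℝ (expTerm B f 0) z (0, 1) = 0 := by
    rw [(hasFDerivAt_expTerm B hfs 0 z).fderiv]; simp
  have hr' := (hasSum_nat_add_iff' 1).2 hr
  simp only [Finset.range_one, Finset.sum_singleton, e0, sub_zero, e1] at hr'
  simp only [e2] at hx
  exact hr'.unique hx

end Existence

end PartialSlice

/-! ### From the multiple Taylor series to a power series of infinite radius -/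

namespace PartialSlice

open Set Filter
open scoped Topology ContDiff Nat NNReal ENNReal

section Taylor

variable {p n : ℕ} {g : BaseSpace p → ComplexClifford n}

instance finiteDimensional_complexClifford (n : ℕ) : FiniteDimensional ℂ (ComplexClifford n) :=
  .of_basis (ComplexClifford.bladeBasis n)

instance completeSpace_complexClifford (n : ℕ) : CompleteSpace (ComplexClifford n) :=
  FiniteDimensional.complete ℂ _

theorem partialX_eq (hg : Differentiable ℝ g) (i : Fin (p + 1)) :
    partialX i g = fun x => fderiv ℝ g x (EuclideanSpace.single i 1) :=
  funext fun x => (hg x).lineDeriv_eq_fderiv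

theorem contDiff_partialX (hg : ContDiff ℝ ∞ g) (i : Fin (p + 1)) :
    ContDiff ℝ ∞ (partialX i g) := by
  rw [partialX_eq (hg.differentiable (by simp))]
  exact (hg.fderiv_right (m := ∞) (by simp)).clm_apply contDiff_const

theorem partialX_comm (hg : ContDiff ℝ ∞ g) (i j : Fin (p + 1)) :
    partialX i (partialX j g) = partialX j (partialX i g) := by
  have hd : ∀ i j x, partialX i (partialX j g) x = fderiv ℝ (fderiv ℝ g) x
      (EuclideanSpace.single i 1) (EuclideanSpace.single j 1) := by
    intro i j x
    rw [partialX_eq ((contDiff_partialX hg j).differentiable (by simp)),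
      partialX_eq (hg.differentiable (by simp))]
    have h1 : Differentiable ℝ (fderiv ℝ g) :=
      (hg.fderiv_right (m := ∞) (by simp)).differentiable (by simp)
    have h := ((h1 x).hasFDerivAt.clm_apply
      (hasFDerivAt_const (EuclideanSpace.single j (1 : ℝ)) x)).fderiv
    simp only [h]; simp
  ext x
  rw [hd, hd]
  exact (hg.contDiffAt (x := x)).isSymmSndFDerivAt
    (by simpa using WithTop.coe_le_coe.2 (le_top : (2 : ℕ∞) ≤ ⊤)) _ _

theorem contDiff_foldr_partialX (hg : ContDiff ℝ ∞ g) (l : List (Fin (p + 1))) :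
    ContDiff ℝ ∞ (l.foldr partialX g) := by
  induction l with
  | nil => exact hg
  | cons i l ih => exact contDiff_partialX ih i

theorem foldr_partialX_perm (hg : ContDiff ℝ ∞ g) {l l' : List (Fin (p + 1))} (h : l.Perm l') :
    l.foldr partialX g = l'.foldr partialX g := by
  induction h with
  | nil => rfl
  | cons i _ ih => rw [List.foldr_cons, List.foldr_cons, ih]
  | swap i j l => exact partialX_comm (contDiff_foldr_partialX hg l) j i
  | trans _ _ ih1 ih2 => exact ih1.trans ih2

theorem mixedPartial_eq_foldr (k : Fin (p + 1) → ℕ) :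
    mixedPartial k g =
      ((List.finRange (p + 1)).flatMap fun i => List.replicate (k i) i).foldr partialX g := by
  rw [mixedPartial]
  induction List.finRange (p + 1) with
  | nil => rfl
  | cons i l ih =>
    rw [List.foldr_cons, List.flatMap_cons, List.foldr_append, ih]
    induction k i with
    | zero => rfl
    | succ m ihm => rw [Function.iterate_succ_apply', ihm]; rfl

/-- Partial derivatives commute, so a word of directions matters only through its letter counts.
This links Fréchet derivatives, indexed by words, with Taylor terms, indexed by multi-indices. -/
theorem foldr_partialX_eq_mixedPartial (hg : ContDiff ℝ ∞ g) (l : List (Fin (p + 1))) :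
    l.foldr partialX g = mixedPartial (fun i => l.count i) g := by
  rw [mixedPartial_eq_foldr]
  refine foldr_partialX_perm hg (List.perm_iff_count.2 fun i => ?_)
  rw [List.count_flatMap]
  simp only [Function.comp_def, List.count_replicate]
  rw [← List.ofFn_eq_map, List.sum_ofFn]
  simp

theorem sum_count_eq_length (l : List (Fin (p + 1))) : ∑ i, l.count i = l.length := by
  simpa using Multiset.sum_count_eq_card (s := Finset.univ) (m := (l : Multiset (Fin (p + 1))))
    (by simp)

theorem iteratedFDeriv_single_eq (hg : ContDiff ℝ ∞ g) (m : ℕ) (i : Fin m → Fin (p + 1))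
    (x : BaseSpace p) :
    iteratedFDeriv ℝ m g x (fun j => EuclideanSpace.single (i j) 1) =
      (List.ofFn i).foldr partialX g x := by
  induction m generalizing x with
  | zero => simp
  | succ m ih =>
    rw [iteratedFDeriv_succ_apply_left, List.ofFn_succ, List.foldr_cons,
      partialX_eq ((contDiff_foldr_partialX hg _).differentiable (by simp))]
    have h1 : (List.ofFn fun j => i j.succ).foldr partialX g =
        fun y => iteratedFDeriv ℝ m g y fun j => EuclideanSpace.single (i j.succ) 1 :=
      funext fun y => (ih (fun j => i j.succ) y).symm
    have h2 : DifferentiableAt ℝ (iteratedFDeriv ℝ m g) x :=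
      (hg.differentiable_iteratedFDeriv (m := m) (mod_cast WithTop.coe_lt_top m)) x
    have h3 := ((ContinuousMultilinearMap.apply ℝ (fun _ : Fin m => BaseSpace p)
      (ComplexClifford n) fun j => EuclideanSpace.single (i j.succ) 1).hasFDerivAt.comp x
        h2.hasFDerivAt).fderiv
    rw [h1]
    exact (DFunLike.congr_fun h3 _).symm

/-- Expanding every argument in the standard basis gives (p + 1)^m words, with coordinates bounded
by the norms. -/
theorem norm_iteratedFDeriv_le_of_foldr_partialX (hg : ContDiff ℝ ∞ g) (m : ℕ) (x : BaseSpace p)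
    {K : ℝ} (hK : ∀ l : List (Fin (p + 1)), l.length = m → ‖l.foldr partialX g x‖ ≤ K) :
    ‖iteratedFDeriv ℝ m g x‖ ≤ (p + 1) ^ m * K := by
  have hK0 : 0 ≤ K := (norm_nonneg _).trans (hK (List.replicate m 0) (by simp))
  refine ContinuousMultilinearMap.opNorm_le_bound (by positivity) fun v => ?_
  have hv : v = fun j => ∑ i, v j i • EuclideanSpace.single i (1 : ℝ) := by
    funext j
    simpa using ((EuclideanSpace.basisFun (Fin (p + 1)) ℝ).sum_repr (v j)).symm
  have h1 : iteratedFDeriv ℝ m g x v = ∑ r : Fin m → Fin (p + 1),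
      (∏ j, v j (r j)) • iteratedFDeriv ℝ m g x fun j => EuclideanSpace.single (r j) 1 := by
    conv_lhs => rw [hv]
    rw [ContinuousMultilinearMap.map_sum]
    exact Finset.sum_congr rfl fun r _ => ContinuousMultilinearMap.map_smul_univ _ _ _
  rw [h1]
  refine (norm_sum_le _ _).trans ?_
  have h2 : ∀ r ∈ (Finset.univ : Finset (Fin m → Fin (p + 1))),
      ‖(∏ j, v j (r j)) • iteratedFDeriv ℝ m g x fun j => EuclideanSpace.single (r j) 1‖ ≤
        (∏ j, ‖v j‖) * K := by
    intro r _
    rw [norm_smul, norm_prod, iteratedFDeriv_single_eq hg]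
    refine mul_le_mul (Finset.prod_le_prod (fun _ _ => norm_nonneg _)
      fun j _ => PiLp.norm_apply_le (v j) (r j)) (hK _ (by simp)) (norm_nonneg _)
      (Finset.prod_nonneg fun _ _ => norm_nonneg _)
  refine (Finset.sum_le_sum h2).trans_eq ?_
  rw [Finset.sum_const, Finset.card_univ, Fintype.card_fun, Fintype.card_fin, Fintype.card_fin,
    nsmul_eq_mul]
  push_cast
  ring

/-- The Taylor series of `g` about `0`. -/
noncomputable def taylorFPS (g : BaseSpace p → ComplexClifford n) :
    FormalMultilinearSeries ℝ (BaseSpace p) (ComplexClifford n) :=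
  fun m => (m ! : ℝ)⁻¹ • iteratedFDeriv ℝ m g 0

/-- At the diagonal point (R, …, R) the monomial of k is R^|k|, and ∏ kᵢ! ≤ |k|!. -/
theorem norm_foldr_partialX_mul_pow_le (hg : ContDiff ℝ ∞ g) {R C : ℝ} (hR : 0 ≤ R)
    (hC : ∀ k, ‖taylorTerm g (WithLp.toLp 2 fun _ => R) k‖ ≤ C) (l : List (Fin (p + 1))) :
    ‖l.foldr partialX g 0‖ * R ^ l.length ≤ C * l.length ! := by
  have h1 := hC fun i => l.count i
  have hfac : (∏ i, ((l.count i)! : ℝ)) ≤ l.length ! := by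
    have h2 := Nat.le_of_dvd (Nat.factorial_pos _)
      (Nat.prod_factorial_dvd_factorial_sum Finset.univ fun i => l.count i)
    rw [sum_count_eq_length] at h2
    exact_mod_cast h2
  have hpos : 0 < ∏ i, ((l.count i)! : ℝ) := Finset.prod_pos fun i _ => by positivity
  rw [taylorTerm, ← foldr_partialX_eq_mixedPartial hg, norm_smul, norm_div, Real.norm_of_nonneg
    hpos.le, Finset.prod_pow_eq_pow_sum, sum_count_eq_length, Real.norm_of_nonneg (by positivity),
    div_mul_eq_mul_div, div_le_iff₀ hpos] at h1
  have hC0 : 0 ≤ C := (norm_nonneg _).trans (hC 0)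
  rw [mul_comm]
  exact h1.trans (by gcongr)

theorem radius_taylorFPS_eq_top (hg : ContDiff ℝ ∞ g)
    (hT : ∀ x, Summable (taylorTerm g x)) : (taylorFPS g).radius = ⊤ := by
  refine ENNReal.eq_top_of_forall_nnreal_le fun r => ?_
  -- Summable terms are bounded; the extra factor p + 1 in the point absorbs the number (p + 1)^m of
  -- words.
  obtain ⟨C, hC⟩ : ∃ C, ∀ k, ‖taylorTerm g (WithLp.toLp 2 fun _ => (p + 1) * r) k‖ ≤ C :=
    ⟨_, fun k => (hT _).norm.le_tsum k fun _ _ => norm_nonneg _⟩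
  refine (taylorFPS g).le_radius_of_bound C fun m => ?_
  have hl := norm_foldr_partialX_mul_pow_le hg (by positivity) hC
  obtain ⟨l₀, hl₀, hmax⟩ : ∃ l₀ : List (Fin (p + 1)), l₀.length = m ∧
      ∀ l : List (Fin (p + 1)), l.length = m →
        ‖l.foldr partialX g 0‖ ≤ ‖l₀.foldr partialX g 0‖ := by
    obtain ⟨i₀, h⟩ := Finite.exists_max fun i : Fin m → Fin (p + 1) =>
      ‖(List.ofFn i).foldr partialX g 0‖
    refine ⟨List.ofFn i₀, by simp, fun l hlm => ?_⟩
    subst hlm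
    simpa using h l.get
  have h1 := norm_iteratedFDeriv_le_of_foldr_partialX hg m 0 hmax
  have h2 := hl l₀
  rw [hl₀] at h2
  rw [taylorFPS, norm_smul, norm_inv, Real.norm_natCast, mul_assoc, inv_mul_le_iff₀ (by positivity)]
  calc ‖iteratedFDeriv ℝ m g 0‖ * r ^ m
      ≤ (p + 1) ^ m * ‖l₀.foldr partialX g 0‖ * r ^ m := by gcongr
    _ = ‖l₀.foldr partialX g 0‖ * ((p + 1) * r) ^ m := by rw [mul_pow]; ring
    _ ≤ C * m ! := h2
    _ = _ := mul_comm _ _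

/-- A real analytic function with everywhere convergent multiple Taylor series about `0` is the
sum of that series. -/
theorem hasFPowerSeriesOnBall_taylorFPS (hg : AnalyticOnNhd ℝ g univ)
    (hT : ∀ x, Summable (taylorTerm g x)) : HasFPowerSeriesOnBall g (taylorFPS g) 0 ⊤ := by
  have hr := radius_taylorFPS_eq_top hg.contDiff hT
  have h1 := (taylorFPS g).hasFPowerSeriesOnBall (by rw [hr]; exact ENNReal.zero_lt_top)
  rw [hr] at h1
  obtain ⟨P, r, hP⟩ := hg 0 (mem_univ _)
  have h2 : (taylorFPS g).sum =ᶠ[𝓝 0] g := by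
    filter_upwards [Metric.eball_mem_nhds (0 : BaseSpace p) hP.r_pos] with y hy
    have := (hP.hasSum_iteratedFDeriv hy).tsum_eq
    rw [zero_add] at this
    rw [← this]
    rfl
  -- Analyticity gives equality near 0 only; the identity theorem extends it to the whole space.
  have h3 : (taylorFPS g).sum = g :=
    AnalyticOnNhd.eq_of_eventuallyEq (by simpa using h1.analyticOnNhd) hg h2
  rwa [h3] at h1

end Taylor

end PartialSlice

/-! ### Clifford algebra: from monogenicity to the evolution system -/

theorem ComplexClifford.gen_mul_gen_add {n : ℕ} (i j : Fin n) :
    (gen i : ComplexClifford n) * gen j + gen j * gen i = if i = j then -2 else 0 := by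
  have h := congrArg
    (Algebra.TensorProduct.includeRight : RealClifford n →ₐ[ℝ] ℂ ⊗[ℝ] RealClifford n) (RealClifford.gen_mul_gen_add i j)
  rw [map_add, map_mul, map_mul] at h
  refine h.trans ?_
  split_ifs
  · rw [map_neg, map_ofNat]; rfl
  · rw [map_zero]; rfl

namespace PartialSlice

open Set Filter
open scoped Topology ContDiff Nat

theorem SolvesEvolution.sub {ι F : Type*} [Fintype ι] [DecidableEq ι] [NormedAddCommGroup F]
    [NormedSpace ℝ F] {B : ι → F →L[ℝ] F} {u w : EuclideanSpace ℝ ι × ℝ → F}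
    (h : SolvesEvolution B u) (hu : Differentiable ℝ u) (hw : Differentiable ℝ w)
    (h' : SolvesEvolution B w) : SolvesEvolution B fun z => u z - w z := by
  intro z
  rw [fderiv_fun_sub (hu z) (hw z)]
  simp only [_root_.sub_apply, map_sub, Finset.sum_sub_distrib, h z, h' z]

section Clifford

variable {p q : ℕ}

theorem toVector_smul (r : ℝ) (y : EuclideanSpace ℝ (Fin q)) :
    toVector p (r • y) = r • toVector p y := by
  simp [toVector, Finset.smul_sum, smul_smul]

theorem toVector_mul_self (y : EuclideanSpace ℝ (Fin q)) :
    toVector p y * toVector p y = -(‖y‖ ^ 2 : ℝ) • (1 : ComplexClifford (p + q)) := by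
  set G : Fin q → ComplexClifford (p + q) := fun j => ComplexClifford.gen (Fin.natAdd p j)
  have hG : ∀ j k, G j * G k + G k * G j = if j = k then (-2 : ℝ) • 1 else 0 := by
    intro j k
    simp only [G, ComplexClifford.gen_mul_gen_add, Fin.natAdd_inj]
    split_ifs
    · rw [neg_smul, ofNat_smul_eq_nsmul, nsmul_eq_mul, mul_one]; rfl
    · rfl
  have h1 : toVector p y * toVector p y = ∑ j, ∑ k, (y j * y k) • (G j * G k) := by
    simp only [toVector, Finset.sum_mul_sum, smul_mul_smul_comm]
    rfl
  have h2 : toVector p y * toVector p y = ∑ j, ∑ k, (y j * y k) • (G k * G j) := by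
    rw [h1, Finset.sum_comm]
    exact Finset.sum_congr rfl fun j _ => Finset.sum_congr rfl fun k _ => by rw [mul_comm]
  have h3 : (2 : ℝ) • (toVector p y * toVector p y) =
      (2 : ℝ) • (-(‖y‖ ^ 2 : ℝ) • (1 : ComplexClifford (p + q))) := by
    rw [two_smul]
    nth_rewrite 1 [h1]
    rw [h2, ← Finset.sum_add_distrib]
    simp only [← Finset.sum_add_distrib, ← smul_add, hG]
    simp only [smul_ite, smul_zero, Finset.sum_ite_eq, Finset.mem_univ, if_true, smul_smul,
      ← Finset.sum_smul, EuclideanSpace.norm_sq_eq, Real.norm_eq_abs, sq_abs]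
    congr 1
    rw [← Finset.sum_mul]
    simp only [← sq]
    ring
  exact smul_right_injective _ (two_ne_zero (α := ℝ)) h3

theorem toVector_mul_gen (y : EuclideanSpace ℝ (Fin q)) (i : Fin p) :
    toVector p y * ComplexClifford.gen (Fin.castAdd q i) =
      -(ComplexClifford.gen (Fin.castAdd q i) * toVector p y) := by
  rw [eq_neg_iff_add_eq_zero, toVector, Finset.sum_mul, Finset.mul_sum, ← Finset.sum_add_distrib]
  refine Finset.sum_eq_zero fun j _ => ?_
  rw [smul_mul_assoc, mul_smul_comm, ← smul_add, ComplexClifford.gen_mul_gen_add, if_neg, smul_zero]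
  intro h
  have := congrArg Fin.val h
  simp at this
  omega

/-- The coefficients of the operator `y̲ D_x`: left multiplication by `y̲ eᵢ`. -/
noncomputable def diracCoeff (p : ℕ) (y : EuclideanSpace ℝ (Fin q)) (i : Fin (p + 1)) :
    ComplexClifford (p + q) →L[ℝ] ComplexClifford (p + q) :=
  LinearMap.toContinuousLinearMap (LinearMap.mulLeft ℝ (toVector p y * baseUnit p q i))

theorem diracCoeff_apply (y : EuclideanSpace ℝ (Fin q)) (i : Fin (p + 1))
    (a : ComplexClifford (p + q)) :
    diracCoeff p y i a = toVector p y * (baseUnit p q i * a) := by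
  rw [← mul_assoc]; rfl

theorem diracCoeff_smul (r : ℝ) (y : EuclideanSpace ℝ (Fin q)) (i : Fin (p + 1)) :
    diracCoeff p (r • y) i = r • diracCoeff p y i := by
  ext a : 1
  rw [_root_.smul_apply, diracCoeff_apply, diracCoeff_apply, toVector_smul, smul_mul_assoc]

/-- With v the vector of η, v² = -1, and v anticommutes with e₁, …, e_p but commutes with e₀ = 1.
Hence (v eᵢ)(v eⱼ) = eᵢ eⱼ for i, j ≥ 1, while v e₀ = v squares to -1 and anticommutes with every v
eⱼ, j ≥ 1. -/
theorem baseUnit_mul_baseUnit_add {η : EuclideanSpace ℝ (Fin q)} (hη : ‖η‖ = 1)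
    (i j : Fin (p + 1)) :
    toVector p η * baseUnit p q i * (toVector p η * baseUnit p q j) +
      toVector p η * baseUnit p q j * (toVector p η * baseUnit p q i) =
        if i = j then -2 else 0 := by
  set v := toVector p η with hv
  have hvv : v * v = -1 := by rw [hv, toVector_mul_self, hη]; simp
  have hve : ∀ i : Fin p, v * ComplexClifford.gen (Fin.castAdd q i) =
    -(ComplexClifford.gen (Fin.castAdd q i) * v) := toVector_mul_gen η
  have h2 : (-1 + -1 : ComplexClifford (p + q)) = -2 := by rw [← one_add_one_eq_two]; abel
  cases i using Fin.cases with
  | zero =>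
    cases j using Fin.cases with
    | zero => simp [baseUnit, hvv, h2]
    | succ j =>
      rw [if_neg (Fin.succ_ne_zero j).symm]
      simp only [baseUnit, Fin.cons_zero, Fin.cons_succ, mul_one]
      rw [← mul_assoc, hvv, hve, neg_mul, neg_mul, mul_assoc _ v v, hvv]
      simp
  | succ i =>
    cases j using Fin.cases with
    | zero =>
      rw [if_neg (Fin.succ_ne_zero i)]
      simp only [baseUnit, Fin.cons_zero, Fin.cons_succ, mul_one]
      rw [← mul_assoc, hvv, hve, neg_mul, mul_assoc, hvv]
      simp
    | succ j =>
      have key : ∀ i j : Fin p, v * ComplexClifford.gen (Fin.castAdd q i) *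
          (v * ComplexClifford.gen (Fin.castAdd q j)) =
          ComplexClifford.gen (Fin.castAdd q i) * ComplexClifford.gen (Fin.castAdd q j) := by
        intro i j
        rw [hve, neg_mul, mul_assoc, ← mul_assoc v v, hvv]
        simp
      simp only [baseUnit, Fin.cons_succ, key, ComplexClifford.gen_mul_gen_add, Fin.succ_inj,
        Fin.castAdd_inj]

theorem diracCoeff_mul_add {η : EuclideanSpace ℝ (Fin q)} (hη : ‖η‖ = 1) (i j : Fin (p + 1)) :
    diracCoeff p η i * diracCoeff p η j + diracCoeff p η j * diracCoeff p η i =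
      if i = j then -2 else 0 := by
  ext a : 1
  have h : (diracCoeff p η i * diracCoeff p η j + diracCoeff p η j * diracCoeff p η i) a =
      (toVector p η * baseUnit p q i * (toVector p η * baseUnit p q j) +
        toVector p η * baseUnit p q j * (toVector p η * baseUnit p q i)) * a := by
    rw [add_mul, mul_assoc (toVector p η * baseUnit p q i) (toVector p η * baseUnit p q j),
      mul_assoc (toVector p η * baseUnit p q j) (toVector p η * baseUnit p q i)]
    rfl
  rw [h, baseUnit_mul_baseUnit_add hη]
  split_ifs
  · rw [neg_mul, ← one_add_one_eq_two, ← one_add_one_eq_two, add_mul, one_mul]; rfl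
  · rw [zero_mul]; rfl

theorem firstOrderOp_diracCoeff {g : BaseSpace p → ComplexClifford (p + q)}
    (hg : Differentiable ℝ g) (y : EuclideanSpace ℝ (Fin q)) :
    firstOrderOp (diracCoeff p y) g = vectorDiracX y g := by
  ext1 x
  simp only [firstOrderOp, vectorDiracX, diracX, diracCoeff_apply, partialX_eq hg, Finset.mul_sum]

theorem iterate_vectorDiracX {f : BaseSpace p → ComplexClifford (p + q)}
    (hf : ContDiff ℝ ∞ f) (y : EuclideanSpace ℝ (Fin q)) (k : ℕ) :
    (vectorDiracX y)^[k] f = (firstOrderOp (diracCoeff p y))^[k] f := by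
  induction k with
  | zero => rfl
  | succ k ih =>
    rw [Function.iterate_succ_apply', Function.iterate_succ_apply', ih, firstOrderOp_diracCoeff
      ((contDiff_iterate_firstOrderOp _ hf k).differentiable (by simp))]

theorem iterate_firstOrderOp_smul {ι F : Type*} [Fintype ι] [DecidableEq ι]
    [NormedAddCommGroup F] [NormedSpace ℝ F] {f : EuclideanSpace ℝ ι → F} (hf : ContDiff ℝ ∞ f)
    (B : ι → F →L[ℝ] F) (r : ℝ) (k : ℕ) :
    (firstOrderOp fun i => r • B i)^[k] f = r ^ k • (firstOrderOp B)^[k] f := by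
  induction k with
  | zero => simp
  | succ k ih =>
    rw [Function.iterate_succ_apply', Function.iterate_succ_apply', ih]
    ext x
    have h := (contDiff_iterate_firstOrderOp B hf k).differentiable (by simp) x
    simp only [firstOrderOp, fderiv_const_smul h, _root_.smul_apply, map_smul, Pi.smul_apply,
      smul_smul, Finset.smul_sum, pow_succ]

/-- The real scalar r leaves the operator as r^k. The vector η may have any length. -/
theorem ckTerm_eq_expTerm {f : BaseSpace p → ComplexClifford (p + q)} (hf : ContDiff ℝ ∞ f)
    (η : EuclideanSpace ℝ (Fin q)) (x : BaseSpace p) (r : ℝ) (k : ℕ) :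
    ckTerm f (x, r • η) k = expTerm (diracCoeff p η) f k (x, r) := by
  have h : diracCoeff p (r • η) = fun i => r • diracCoeff p η i := funext fun i =>
    diracCoeff_smul r η i
  rw [ckTerm, iterate_vectorDiracX hf, h, iterate_firstOrderOp_smul hf, expTerm, Pi.smul_apply,
    smul_smul, div_eq_inv_mul]

/-- Multiplication by η is invertible since η² = -1, and it carries each equation to the other up to
sign. -/
theorem solvesEvolution_diracCoeff_iff {η : EuclideanSpace ℝ (Fin q)} (hη : ‖η‖ = 1)
    {u : BaseSpace p × ℝ → ComplexClifford (p + q)} (hu : Differentiable ℝ u) :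
    SolvesEvolution (diracCoeff p η) u ↔ ∀ x r,
      diracX (fun x' => u (x', r)) x + toVector p η * deriv (fun s : ℝ => u (x, s)) r = 0 := by
  have hvv : toVector p η * toVector p η = -1 := by rw [toVector_mul_self, hη]; simp
  have hr : ∀ x r, deriv (fun s : ℝ => u (x, s)) r = fderiv ℝ u (x, r) (0, 1) := by
    intro x r
    have h1 : HasDerivAt (fun s : ℝ => (x, s)) ((0 : BaseSpace p), (1 : ℝ)) r :=
      (hasDerivAt_const r x).prodMk (hasDerivAt_id r)
    exact ((hu (x, r)).hasFDerivAt.comp_hasDerivAt r h1).deriv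
  have hx : ∀ x r i, partialX i (fun x' => u (x', r)) x =
      fderiv ℝ u (x, r) (EuclideanSpace.single i 1, 0) := by
    intro x r i
    have h0 : HasFDerivAt (fun x' : BaseSpace p => (x', r))
      (ContinuousLinearMap.inl ℝ (BaseSpace p) ℝ) x := hasFDerivAt_prodMk_left x r
    have h1 := HasFDerivAt.comp (g := u) x (hu (x, r)).hasFDerivAt h0
    have h2 := (h1.hasLineDerivAt (EuclideanSpace.single i 1)).lineDeriv
    exact h2.trans (by simp)
  have hD : ∀ x r, toVector p η * diracX (fun x' => u (x', r)) x =
      ∑ i, diracCoeff p η i (fderiv ℝ u (x, r) (EuclideanSpace.single i 1, 0)) := by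
    intro x r
    simp only [diracX, hx, diracCoeff_apply, Finset.mul_sum]
  constructor
  · intro h x r
    rw [hr, h (x, r), ← hD, ← mul_assoc, hvv]; simp
  · rintro h ⟨x, r⟩
    have h1 := congrArg (toVector p η * ·) (h x r)
    simp only [mul_add, mul_zero, ← mul_assoc, hvv, hr] at h1
    rw [hD, neg_mul, one_mul, ← sub_eq_add_neg, sub_eq_zero] at h1
    exact h1.symm

end Clifford

end PartialSlice

/-! ### The corollary -/

theorem mainTheorem6 (p q : ℕ) (hq : 1 ≤ q)
    (f₀ : PartialSlice.BaseSpace p → ComplexClifford (p + q))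
    (hf₀ : AnalyticOnNhd ℝ f₀ Set.univ)
    (hTaylor : ∀ x : PartialSlice.BaseSpace p, Summable (PartialSlice.taylorTerm f₀ x)) :
    (∀ z : PartialSlice.TotalSpace p q, Summable (PartialSlice.ckTerm f₀ z)) ∧
    PartialSlice.IsCKExtension Set.univ f₀ Set.univ (PartialSlice.CK f₀) ∧
    ∀ f : PartialSlice.TotalSpace p q → ComplexClifford (p + q),
      PartialSlice.IsCKExtension Set.univ f₀ Set.univ f → f = PartialSlice.CK f₀ := by
  have hP := PartialSlice.hasFPowerSeriesOnBall_taylorFPS hf₀ hTaylor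
  have hslice : ∀ (ω : EuclideanSpace ℝ (Fin q)) (x : PartialSlice.BaseSpace p) (r : ℝ),
      PartialSlice.CK f₀ (x, r • ω) =
        ∑' k, PartialSlice.expTerm (PartialSlice.diracCoeff p ω) f₀ k (x, r) := fun ω x r =>
    tsum_congr fun k => PartialSlice.ckTerm_eq_expTerm hf₀.contDiff ω x r k
  have hU : ∀ ω : EuclideanSpace ℝ (Fin q),
      ContDiff ℝ 1 (fun z : PartialSlice.BaseSpace p × ℝ => PartialSlice.CK f₀ (z.1, z.2 • ω)) ∧
        PartialSlice.SolvesEvolution (PartialSlice.diracCoeff p ω)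
          fun z => PartialSlice.CK f₀ (z.1, z.2 • ω) := by
    intro ω
    simp only [hslice]
    exact PartialSlice.contDiff_and_solvesEvolution_tsum_expTerm _ hP
  have hzero : ∀ x, PartialSlice.CK f₀ (x, (0 : EuclideanSpace ℝ (Fin q))) = f₀ x := by
    intro x
    rw [← zero_smul ℝ (0 : EuclideanSpace ℝ (Fin q)), hslice, PartialSlice.tsum_expTerm_zero]
  refine ⟨fun ⟨x, y⟩ => ?_, ?_, fun f hf => ?_⟩
  -- Convergence needs no unit vector: y itself is the direction, with r = 1.
  · rw [← one_smul ℝ y]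
    exact (PartialSlice.summable_expTerm (PartialSlice.diracCoeff p y) hP (x, 1)).congr fun k =>
      (PartialSlice.ckTerm_eq_expTerm hf₀.contDiff y x 1 k).symm
  · exact
      { subset_cylinder := fun _ _ => Set.mem_univ _
        base_subset := fun _ _ => Set.mem_univ _
        isGSM :=
          { isOpen := isOpen_univ
            isConnected := isConnected_univ
            contDiffOn := fun ω _ => (hU ω).1.contDiffOn
            cauchyRiemann := fun ω hω x r _ =>
              (PartialSlice.solvesEvolution_diracCoeff_iff hω
                ((hU ω).1.differentiable one_ne_zero)).1 (hU ω).2 x r }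
        restrict_eq := fun x _ => hzero x }
  · ext1 ⟨x, y⟩
    by_cases hy : y = 0
    · rw [hy, hzero, hf.restrict_eq x (Set.mem_univ x)]
    -- Off the base space y lies on the slice of its own direction, where the two extensions have
    -- the same Cauchy data.
    · set ω := ‖y‖⁻¹ • y with hωdef
      have hy0 : ‖y‖ ≠ 0 := norm_ne_zero_iff.2 hy
      have hω : ‖ω‖ = 1 := by rw [hωdef, norm_smul, norm_inv, norm_norm, inv_mul_cancel₀ hy0]
      have hyω : y = ‖y‖ • ω := by rw [hωdef, smul_smul, mul_inv_cancel₀ hy0, one_smul]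
      have hfd : ContDiff ℝ 1 fun z : PartialSlice.BaseSpace p × ℝ => f (z.1, z.2 • ω) := by
        rw [← contDiffOn_univ]
        exact (hf.isGSM.contDiffOn ω hω).mono fun _ _ => Set.mem_univ _
      have hfs := (PartialSlice.solvesEvolution_diracCoeff_iff hω
        (hfd.differentiable one_ne_zero)).2 fun x r =>
          hf.isGSM.cauchyRiemann ω hω x r (Set.mem_univ _)
      have hdiff := (hfs.sub (hfd.differentiable one_ne_zero)
        ((hU ω).1.differentiable one_ne_zero) (hU ω).2).eq_zero
          (PartialSlice.diracCoeff_mul_add hω) (hfd.sub (hU ω).1) fun x => by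
            simp [hzero, hf.restrict_eq x (Set.mem_univ x)]
      have := congrFun hdiff (x, ‖y‖)
      rw [hyω]
      exact sub_eq_zero.1 this
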